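/- Let $E$ and $E'$ be elliptic curves over $\mathbb{Q}$ and let $\varphi\colon E\to E'$ be a $\mathbb{Q}$-isogeny (a non-constant morphism of curves defined over $\mathbb{Q}$ that is a homomorphism on $\overline{\mathbb{Q}}$-points) whose kernel is finite, cyclic and $\mathbb{Q}$-rational, i.e. stable under $G_{\mathbb{Q}}=\operatorname{Gal}(\overline{\mathbb{Q}}/\mathbb{Q})$. Let $\ell$ be a prime and let $\ell^{r}$ be the greatest power of $\ell$ dividing $\deg\varphi=\#\ker\varphi$. For a basis $\{P,Q\}$ of $E[n]\cong(\mathbb{Z}/n\mathbb{Z})^2$ let $\overline{\rho}_{E,n}\colon G_{\mathbb{Q}}\to \operatorname{GL}(2,\mathbb{Z}/n\mathbb{Z})$ be the Galois representation on $E[n]$, where $\overline{\rho}_{E,n}(\sigma)=\begin{bmatrix}A&C\\B&D\end{bmatrix}$ means $\sigma(P)=[A]P+[B]Q$ and $\sigma(Q)=[C]P+[D]Q$. For a $\mathbb{Z}_\ell$-basis of the Tate module of $E$, that is, a system of bases $\{P_n,Q_n\}$ of $E[\ell^n]$, $n\ge 0$, with $[\ell]P_{n+1}=P_n$ and $[\ell]Q_{n+1}=Q_n$,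 let $\rho_{E,\ell^\infty}(G_{\mathbb{Q}})=\varprojlim_n\overline{\rho}_{E,\ell^n}(G_{\mathbb{Q}})\subseteq\operatorname{GL}(2,\mathbb{Z}_\ell)$ be the $\ell$-adic Galois image. 1. For every integer $m\ge 0$ there is a basis $\{P,Q\}$ of $E[\ell^{m+r}]$ such that $\{\varphi([\ell^{r}]P),\varphi(Q)\}$ is a basis of $E'[\ell^{m}]$ and such that for every $\sigma\in G_{\mathbb{Q}}$ there are integers $A,B,C,D$ with $\ell^{r}\mid C$, $$\overline{\rho}_{E,\ell^{m+r}}(\sigma)=\begin{bmatrix}A&C\\B&D\end{bmatrix}\quad\text{and}\quad \overline{\rho}_{E',\ell^{m}}(\sigma)=\begin{bmatrix}A&C/\ell^{r}\\ \ell^{r}B&D\end{bmatrix}$$ in these bases. 2. The Tate modules of $E$ and $E'$ have such bases, and for any choice of them: (a) if $\ell\nmid\deg\varphi$, then $\rho_{E,\ell^\infty}(G_{\mathbb{Q}})$ and $\rho_{E',\ell^\infty}(G_{\mathbb{Q}})$ are conjugate in $\operatorname{GL}(2,\mathbb{Z}_\ell)$; (b) for every integer $\alpha$ not divisible by $\ell$,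 $\rho_{E,\ell^\infty}(G_{\mathbb{Q}})$ contains $\alpha\cdot\operatorname{Id}$ if and only if $\rho_{E',\ell^\infty}(G_{\mathbb{Q}})$ does; in particular, $\rho_{E,\ell^\infty}(G_{\mathbb{Q}})$ contains $-\operatorname{Id}$ if and only if $\rho_{E',\ell^\infty}(G_{\mathbb{Q}})$ does. -/

import Mathlib

open scoped WeierstrassCurve

namespace EllQ

/-- The field `ℚ̄` of algebraic numbers. -/
abbrev QBar : Type := AlgebraicClosure ℚ

noncomputable instance instDecidableEqQBar : DecidableEq QBar := Classical.decEq QBar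

/-- The absolute Galois group `G_ℚ = Gal(ℚ̄/ℚ)`. -/
abbrev GQ : Type := QBar ≃ₐ[ℚ] QBar

/-- The group `E(ℚ̄)` of geometric points of an elliptic curve `E` over `ℚ`. -/
abbrev Pts (E : WeierstrassCurve ℚ) : Type := WeierstrassCurve.Affine.Point (E⁄QBar)

/-- The action of `σ ∈ G_ℚ` on `E(ℚ̄)`, coordinate by coordinate. -/
noncomputable def galAct (E : WeierstrassCurve ℚ) (σ : GQ) : Pts E →+ Pts E :=
  WeierstrassCurve.Affine.Point.map (W' := E) (σ : QBar →ₐ[ℚ] QBar)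

/-- Homogeneous coordinates of a point in the projective plane: `[0 : 1 : 0]` for the point at
infinity and `[x : y : 1]` for an affine point `(x, y)`. -/
noncomputable def projCoords {E : WeierstrassCurve ℚ} : Pts E → Fin 3 → QBar
  | .zero => ![0, 1, 0]
  | .some x y _ => ![x, y, 1]

/-- A map `f : E(ℚ̄) → E'(ℚ̄)` is a morphism of projective curves defined over `ℚ`: around every
point `P` it is given by three homogeneous polynomials of the same degree with coefficients in `ℚ`
that do not vanish simultaneously at `P` (and that represent `f` wherever they do not vanish
simultaneously). -/
def IsMorphismOverQ {E E' : WeierstrassCurve ℚ} (f : Pts E → Pts E') : Prop :=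
  ∀ P : Pts E, ∃ (d : ℕ) (F : Fin 3 → MvPolynomial (Fin 3) ℚ),
    (∀ i, (F i).IsHomogeneous d) ∧
    (∃ i, MvPolynomial.aeval (projCoords P) (F i) ≠ 0) ∧
    ∀ Q : Pts E, (∃ i, MvPolynomial.aeval (projCoords Q) (F i) ≠ 0) →
      ∃ u : QBar, u ≠ 0 ∧
        ∀ i, MvPolynomial.aeval (projCoords Q) (F i) = u * projCoords (f Q) i

/-- A `ℚ`-isogeny `E → E'`: a non-constant homomorphism `E(ℚ̄) → E'(ℚ̄)` which is a morphism of
curves defined over `ℚ`. -/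
structure Isogeny (E E' : WeierstrassCurve ℚ) where
  /-- the map on geometric points -/
  toHom : Pts E →+ Pts E'
  isMorphism : IsMorphismOverQ toHom
  nonconstant : ∃ P, toHom P ≠ 0

/-- The kernel of an isogeny, as a group of geometric points. -/
noncomputable def Isogeny.ker {E E' : WeierstrassCurve ℚ} (φ : Isogeny E E') : AddSubgroup (Pts E) :=
  φ.toHom.ker

/-- A group `H` of geometric points is `ℚ`-rational if `σ(H) = H` for all `σ ∈ G_ℚ`. -/
def IsQRational {E : WeierstrassCurve ℚ} (H : AddSubgroup (Pts E)) : Prop :=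
  ∀ σ : GQ, H.map (galAct E σ) = H

/-- The torsion group `E[n]`. -/
abbrev Tors (E : WeierstrassCurve ℚ) (n : ℕ) : Type :=
  ↥(AddSubgroup.torsionBy (Pts E) (n : ℤ))

noncomputable instance instModuleTors (E : WeierstrassCurve ℚ) (n : ℕ) :
    Module (ZMod n) (Tors E n) :=
  AddSubgroup.torsionBy.zmodModule

/-- The action of `σ ∈ G_ℚ` on `E[n]`. -/
noncomputable def torsAct (E : WeierstrassCurve ℚ) (n : ℕ) (σ : GQ) :
    Tors E n →ₗ[ZMod n] Tors E n :=
  AddMonoidHom.toZModLinearMap n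
    (((galAct E σ).comp (AddSubgroup.torsionBy (Pts E) (n : ℤ)).subtype).codRestrict
      (AddSubgroup.torsionBy (Pts E) (n : ℤ)) (by
        intro P
        rw [AddSubgroup.torsionBy.nsmul_iff]
        have h := AddSubgroup.torsionBy.nsmul_iff.mp P.2
        change n • galAct E σ (P : Pts E) = 0
        rw [← map_nsmul, h, map_zero]))

@[simp]
theorem coe_torsAct (E : WeierstrassCurve ℚ) (n : ℕ) (σ : GQ) (P : Tors E n) :
    (torsAct E n σ P : Pts E) = galAct E σ P := rfl

/-- The action of `G_ℚ` on `E[n]` as a homomorphism to the endomorphisms of `E[n]`. -/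
noncomputable def torsRep (E : WeierstrassCurve ℚ) (n : ℕ) :
    GQ →* Module.End (ZMod n) (Tors E n) where
  toFun := torsAct E n
  map_one' := by
    ext P
    rw [coe_torsAct]
    rcases P with ⟨_ | _, _⟩ <;> rfl
  map_mul' σ τ := by
    ext P
    rw [coe_torsAct]
    rcases P with ⟨_ | _, _⟩ <;> rfl

/-- The mod-`n` Galois representation `G_ℚ → GL(2, ℤ/nℤ)` in a basis `b` of `E[n]`; column `j` of
the matrix of `σ` holds the coordinates of `σ(b j)`. -/
noncomputable def modRep (E : WeierstrassCurve ℚ) (n : ℕ)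
    (b : Module.Basis (Fin 2) (ZMod n) (Tors E n)) : GQ →* GL (Fin 2) (ZMod n) :=
  (((LinearMap.toMatrixAlgEquiv b : _ →* Matrix (Fin 2) (Fin 2) (ZMod n))).comp
    (torsRep E n)).toHomUnits

/-- A compatible system of bases of the groups `E[ℓ^n]`, that is, a `ℤ_ℓ`-basis of the Tate
module of `E`. -/
structure TateBasis (ℓ : ℕ) (E : WeierstrassCurve ℚ) where
  basis : ∀ n : ℕ, Module.Basis (Fin 2) (ZMod (ℓ ^ n)) (Tors E (ℓ ^ n))
  compat : ∀ (n : ℕ) (i : Fin 2), ℓ • (basis (n + 1) i : Pts E) = (basis n i : Pts E)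

/-- The `ℓ`-adic Galois image `ρ_{E,ℓ^∞}(G_ℚ) = lim ρ_{E,ℓ^n}(G_ℚ)` in `GL(2, ℤ_ℓ)`: the matrices
whose reduction modulo `ℓ^n` lies in the mod-`ℓ^n` image, for every `n`. -/
noncomputable def adicImage {ℓ : ℕ} [Fact ℓ.Prime] {E : WeierstrassCurve ℚ} (b : TateBasis ℓ E) :
    Subgroup (GL (Fin 2) ℤ_[ℓ]) :=
  ⨅ n : ℕ, (modRep E (ℓ ^ n) (b.basis n)).range.comap
    (Matrix.GeneralLinearGroup.map (PadicInt.toZModPow n))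

/-- The subgroup `H` of `GL(2, ℤ_ℓ)` contains the scalar matrix `a · Id`. -/
def ContainsScalar {ℓ : ℕ} [Fact ℓ.Prime] (H : Subgroup (GL (Fin 2) ℤ_[ℓ])) (a : ℤ_[ℓ]) : Prop :=
  ∃ M ∈ H, (M : Matrix (Fin 2) (Fin 2) ℤ_[ℓ]) = !![a, 0; 0, a]

end EllQ

/-!
The structure of the torsion of an elliptic curve over an algebraically closed field `F` of
characteristic zero is established first; the rest is linear algebra over `ℤ / ℓ ^ n`.

**Torsion.** The symmetric functions of `x(P + Q)` and `x(P - Q)` are given by quadratic forms in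
the symmetric functions of `x(P)` and `x(Q)`, without base points (`addSubMap_sym2x`). Applied to
the pair `(n + 1) • P`, `P`, this gives a recursion for the fraction `f / g` in lowest terms that
expresses `x(n • P)` in `x(P)`: the quadratic form over `F[X]` whose roots are `x((n + 2) • P)` and
`x(n • P)` is known, and so is one of its roots. The degrees
`d n` of the numerators satisfy `d (n + 2) + d n = 2 * d (n + 1) + 2`, whence `deg f = n²` and `deg g < n²` (`exists_isXMul`).
Solving `f = c g` shows that multiplication by `n` is surjective. For `c` outside a finite set
`f - c g` is separable, since the wronskian of `f` and `g` does not vanish, and a fibre of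
multiplication by `n` has `n²` elements; so has the `n`-torsion (`ncard_nsmul_eq_zero`). Divisibility
and this count yield bases of the `ℓ ^ n`-torsion, compatible in `n`, with a prescribed second vector
of order `ℓ ^ n`.

**Isogenies.** An isogeny `φ` commutes with the Galois action because it is given by polynomials
with rational coefficients. Let `K` generate the `ℓ`-primary part of the kernel, a group of order
`ℓ ^ r`, and choose a basis `P, Q` of `E[ℓ ^ (m + r)]` with `ℓ ^ m • Q = K`. Then `φ (ℓ ^ r • P)`
and `φ Q` are independent modulo `ℓ ^ m`, and form a basis of `E'[ℓ ^ m]` by counting. As `K` spans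
a Galois stable group, `ℓ ^ r` divides the coefficient of `P` in `σ Q`, and the two matrices of `σ`
are read off (`exists_bases_modRep`).

**Adic images.** Containing the scalar `a` means that at each level some `σ` acts as `a`. If `σ` acts
as `a` on `E[ℓ ^ (m + r)]`, it does so on `E'[ℓ ^ m]`, which is contained in its image. If it acts as
`a` on `E'[ℓ ^ (m + r)]`, then `σ R - a R` is in the `ℓ`-primary part of the kernel for
`R ∈ E[ℓ ^ (m + r)]`, so is killed by `ℓ ^ r`, and `σ` acts as `a` on `E[ℓ ^ m]`. If `ℓ` does not
divide the degree, `φ` is an isomorphism on `ℓ ^ n`-torsion for every `n`; its matrices are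
compatible and their limit conjugates the `ℓ`-adic images.
-/

/-! ### The `x`-coordinates of the sum and the difference of two points -/

namespace WeierstrassCurve.Affine.Point

variable {F : Type*} [Field F] [DecidableEq F] {W : WeierstrassCurve.Affine F}

omit [DecidableEq F] in
theorem addSubMap_eval (s : Fin 3 → F) :
    (fun i ↦ (addSubMap W i).eval s) =
      ![s 0 ^ 2 - W.b₄ * s 0 * s 2 - W.b₆ * s 1 * s 2 - W.b₈ * s 2 ^ 2,
        2 * s 1 * s 0 + W.b₂ * s 0 * s 2 + W.b₄ * s 1 * s 2 + W.b₆ * s 2 ^ 2,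
        s 1 ^ 2 - 4 * s 0 * s 2] := by
  ext i
  fin_cases i <;> simp [addSubMap]

/-- The case `P = Q` of `addSubMap_sym2x`, that is, the duplication formula. -/
theorem addSubMap_sym2x_self [W.IsElliptic] (P : W.Point) :
    ∃ u : F, u ≠ 0 ∧ (fun i ↦ (addSubMap W i).eval (P.sym2x P)) =
      u • (P + P).sym2x (P - P) := by
  -- when `2 • P = 0` only one coordinate survives, and base point freeness shows that it is nonzero
  have hne := addSubMap_ne_zero W (sym2x_ne_zero P P)
  rw [addSubMap_eval] at hne ⊢
  rcases P with _ | ⟨x, y, h⟩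
  · exact ⟨1, one_ne_zero, by simp [← zero_def]⟩
  rw [sub_self]
  have heq := (W.equation_iff x y).mp h.1
  by_cases hy : y = W.negY x y
  · rw [add_self_of_Y_eq hy]
    rw [negY] at hy
    have h1 : (2 * (x + x) * (x * x) + W.b₂ * (x * x) + W.b₄ * (x + x) + W.b₆ : F) = 0 := by
      simp only [b₂, b₄, b₆]
      linear_combination (2 * y + W.a₁ * x + W.a₃) * hy - 4 * heq
    have h2 : ((x + x) ^ 2 - 4 * (x * x) : F) = 0 := by ring
    simp only [sym2x_some_some] at hne ⊢
    simp only [Matrix.cons_val, mul_one, one_pow, h1, h2] at hne ⊢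
    refine ⟨(x * x) ^ 2 - W.b₄ * (x * x) - W.b₆ * (x + x) - W.b₈, fun h ↦ hne ?_, ?_⟩
    · ext i
      fin_cases i <;> simp [h]
    · change _ = _ • sym2x (0 : W.Point) 0
      rw [sym2x_zero_zero]
      ext i
      fin_cases i <;> simp
  · rw [add_self_of_Y_ne hy]
    have hy' : y - W.negY x y ≠ 0 := sub_ne_zero.mpr hy
    refine ⟨(y - W.negY x y) ^ 2, pow_ne_zero _ hy', ?_⟩
    rw [sym2x_some_some, sym2x_some_zero, slope_of_Y_ne rfl hy, addX]
    simp only [b₂, b₄, b₆, b₈, negY] at hy' ⊢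
    generalize hD : y - (-y - W.a₁ * x - W.a₃) = D at hy' ⊢
    ext i
    fin_cases i
    · simp; field_simp; grind
    · simp; grind
    · simp; ring

/-- The quadratic forms `addSubMap` send the homogeneous symmetric functions of `x(P)` and `x(Q)` to
those of `x(P + Q)` and `x(P - Q)`, for all points `P` and `Q`. -/
theorem addSubMap_sym2x [W.IsElliptic] (P Q : W.Point) :
    ∃ u : F, u ≠ 0 ∧ (fun i ↦ (addSubMap W i).eval (P.sym2x Q)) =
      u • (P + Q).sym2x (P - Q) := by
  by_cases hPQ : P = Q ∨ P = -Q
  · rcases hPQ with rfl | rfl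
    · exact addSubMap_sym2x_self P
    · obtain ⟨u, hu, h⟩ := addSubMap_sym2x_self Q
      refine ⟨u, hu, ?_⟩
      rw [sym2x_neg_left, h, sym2x_comm, neg_add_cancel, sub_self, ← neg_add', sym2x_neg_right]
  rcases P with _ | ⟨x₁, y₁, h₁⟩
  · rcases Q with _ | ⟨x₂, y₂, h₂⟩
    · simp at hPQ
    refine ⟨1, one_ne_zero, ?_⟩
    rw [addSubMap_eval, ← zero_def, zero_add, zero_sub, sym2x_neg_right, sym2x_zero_some,
      sym2x_some_some]
    ext i
    fin_cases i <;> simp <;> ring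
  · rcases Q with _ | ⟨x₂, y₂, h₂⟩
    · refine ⟨1, one_ne_zero, ?_⟩
      rw [addSubMap_eval, ← zero_def, add_zero, sub_zero, sym2x_some_zero, sym2x_some_some]
      ext i
      fin_cases i <;> simp <;> ring
    have hx : x₁ ≠ x₂ := fun h ↦ hPQ (X_eq_iff.mp h)
    have hx' : x₁ - x₂ ≠ 0 := sub_ne_zero.mpr hx
    refine ⟨(x₁ - x₂) ^ 2, pow_ne_zero _ hx', ?_⟩
    have e₁ := (W.equation_iff x₁ y₁).mp h₁.1
    have e₂ := (W.equation_iff x₂ y₂).mp h₂.1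
    rw [addSubMap_eval, sub_eq_add_neg (some x₁ y₁ h₁), neg_some, add_of_X_ne hx,
      add_of_X_ne hx, sym2x_some_some, sym2x_some_some, slope_of_X_ne hx, slope_of_X_ne hx, addX, addX]
    simp only [b₂, b₄, b₆, b₈, negY]
    ext i
    fin_cases i
    · simp; field_simp; grind
    · simp; field_simp; grind
    · simp; ring

end WeierstrassCurve.Affine.Point

/-! ### Multiplication by an integer on `x`-coordinates -/

namespace WeierstrassCurve.Affine

open Polynomial Point

variable {F : Type*} [Field F] [DecidableEq F]

/-- The pair of polynomials `(f, g)` represents multiplication by `n` on `x`-coordinates: for every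
affine point `P = (x, y)`, the pair `(f(x), g(x))` is a nonzero multiple of the homogeneous
`x`-coordinate of `n • P`. -/
def IsXMul (W : Affine F) (n : ℕ) (f g : F[X]) : Prop :=
  ∀ (x y : F) (h : W.Nonsingular x y), ∃ u : F, u ≠ 0 ∧
    f.eval x = u * (n • some x y h).xRep 0 ∧ g.eval x = u * (n • some x y h).xRep 1

variable {W : Affine F}

omit [DecidableEq F] in
theorem exists_nonsingular [IsAlgClosed F] [W.IsElliptic] (x : F) :
    ∃ y, W.Nonsingular x y := by
  obtain ⟨y, hy⟩ := IsAlgClosed.exists_root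
    (X ^ 2 + C (W.a₁ * x + W.a₃) * X - C (x ^ 3 + W.a₂ * x ^ 2 + W.a₄ * x + W.a₆) : F[X])
    (by
      have : (X ^ 2 + C (W.a₁ * x + W.a₃) * X - C (x ^ 3 + W.a₂ * x ^ 2 + W.a₄ * x + W.a₆) :
        F[X]).degree = 2 := by compute_degree!
      rw [this]; decide)
  refine ⟨y, (equation_iff_nonsingular ..).mp ((W.equation_iff x y).mpr ?_)⟩
  simp only [IsRoot.def, eval_sub, eval_add, eval_mul, eval_pow, eval_X, eval_C] at hy
  linear_combination hy

theorem IsXMul.isCoprime [IsAlgClosed F] [W.IsElliptic] {n : ℕ} {f g : F[X]}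
    (h : IsXMul W n f g) : IsCoprime f g := by
  rw [Polynomial.isCoprime_iff_aeval_ne_zero_of_isAlgClosed F F]
  intro x
  obtain ⟨y, hy⟩ := exists_nonsingular (W := W) x
  obtain ⟨u, hu, h0, h1⟩ := h x y hy
  by_contra! hc
  simp only [coe_aeval_eq_eval] at hc
  rw [h0, h1, mul_eq_zero_iff_left hu, mul_eq_zero_iff_left hu] at hc
  refine xRep_ne_zero (n • some x y hy) ?_
  ext i
  fin_cases i
  · exact hc.1
  · exact hc.2

theorem isXMul_zero : IsXMul W 0 1 0 := fun x y h ↦ ⟨1, one_ne_zero, by simp, by simp⟩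

theorem isXMul_one : IsXMul W 1 X 1 := fun x y h ↦ ⟨1, one_ne_zero, by simp, by simp⟩

omit [DecidableEq F] in
/-- A binary quadratic form `F₂ Y² - F₁ Y Z + F₀ Z²` over the polynomials that vanishes at a coprime
pair `(f, g)` is the product of `g Y - f Z` and another linear form `c Y - d Z`. -/
theorem exists_factor_of_isCoprime {f g F₀ F₁ F₂ : F[X]} (hfg : IsCoprime f g) (hf : f.Monic)
    (h : F₂ * f ^ 2 - F₁ * f * g + F₀ * g ^ 2 = 0) :
    ∃ c d : F[X], F₀ = f * d ∧ F₁ = c * f + d * g ∧ F₂ = g * c := by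
  rcases eq_or_ne g 0 with rfl | hg
  · obtain rfl : f = 1 := hf.eq_one_of_isUnit (isCoprime_zero_right.mp hfg)
    exact ⟨F₁, F₀, by simp, by simp, by simpa using h⟩
  · obtain ⟨c, rfl⟩ : g ∣ F₂ := by
      refine (hfg.symm.pow_right (n := 2)).dvd_of_dvd_mul_right ⟨F₁ * f - F₀ * g, ?_⟩
      linear_combination h
    obtain ⟨d, rfl⟩ : f ∣ F₀ := by
      refine (hfg.pow_right (n := 2)).dvd_of_dvd_mul_right ⟨F₁ * g - g * c * f, ?_⟩
      linear_combination h
    refine ⟨c, d, rfl, ?_, rfl⟩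
    refine mul_left_cancel₀ (mul_ne_zero hf.ne_zero hg) ?_
    linear_combination -h

/-- The recursion step: the representatives for `n` and `n + 1` determine one for `n + 2`. -/
theorem IsXMul.exists_succ_succ [IsAlgClosed F] [W.IsElliptic] {n : ℕ} {f g f₁ g₁ : F[X]}
    (h : IsXMul W n f g) (hf : f.Monic) (hfn : f.natDegree = n ^ 2)
    (hgn : g.degree < (n ^ 2 : ℕ))
    (h₁ : IsXMul W (n + 1) f₁ g₁) (hf₁ : f₁.Monic) (hfn₁ : f₁.natDegree = (n + 1) ^ 2)
    (hgn₁ : g₁.degree < ((n + 1) ^ 2 : ℕ)) :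
    ∃ f₂ g₂ : F[X], IsXMul W (n + 2) f₂ g₂ ∧ f₂.Monic ∧ f₂.natDegree = (n + 2) ^ 2 ∧
      g₂.degree < ((n + 2) ^ 2 : ℕ) := by
  -- `(s₀, s₁, g₁)` are the symmetric functions of `f₁ / g₁` and `X`, the `x`-coordinates of
  -- `(n + 1) • P` and `P`; `(F₀, F₁, F₂)` is their image under `addSubMap`
  set s₀ : F[X] := X * f₁ with hs₀
  set s₁ : F[X] := f₁ + X * g₁ with hs₁
  set F₀ : F[X] := s₀ ^ 2 - C W.b₄ * s₀ * g₁ - C W.b₆ * s₁ * g₁ - C W.b₈ * g₁ ^ 2 with hF₀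
  set F₁ : F[X] := C 2 * s₁ * s₀ + C W.b₂ * s₀ * g₁ + C W.b₄ * s₁ * g₁ + C W.b₆ * g₁ ^ 2 with hF₁
  set F₂ : F[X] := s₁ ^ 2 - C 4 * s₀ * g₁ with hF₂
  have key (x y : F) (hxy : W.Nonsingular x y) : ∃ z : F, z ≠ 0 ∧
      ![F₀.eval x, F₁.eval x, F₂.eval x] =
        z • ((n + 2) • some x y hxy).sym2x (n • some x y hxy) := by
    obtain ⟨u, hu, e₀, e₁⟩ := h₁ x y hxy
    obtain ⟨v, hv, e⟩ := addSubMap_sym2x ((n + 1) • some x y hxy) (some x y hxy)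
    refine ⟨u ^ 2 * v, mul_ne_zero (pow_ne_zero _ hu) hv, ?_⟩
    have e2 : (n + 1) • some x y hxy + some x y hxy = (n + 2) • some x y hxy := by
      rw [add_smul, add_smul, one_smul, two_smul, add_assoc]
    have e3 : (n + 1) • some x y hxy - some x y hxy = n • some x y hxy := by
      rw [add_smul, one_smul, add_sub_cancel_right]
    rw [e2, e3, addSubMap_eval] at e
    rw [mul_smul, ← e]
    ext i
    fin_cases i <;> simp [hF₀, hF₁, hF₂, hs₀, hs₁, e₀, e₁, sym2x] <;> ring
  -- `x(n • P)` is a root of the quadratic form with roots `x((n + 2) • P)` and `x(n • P)`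
  have hquad : F₂ * f ^ 2 - F₁ * f * g + F₀ * g ^ 2 = 0 := by
    refine Polynomial.funext fun x ↦ ?_
    obtain ⟨y, hy⟩ := exists_nonsingular (W := W) x
    obtain ⟨z, hz, e⟩ := key x y hy
    obtain ⟨u, hu, e₀, e₁⟩ := h x y hy
    have E₀ := congr_fun e 0
    have E₁ := congr_fun e 1
    have E₂ := congr_fun e 2
    simp only [sym2x, Matrix.cons_val, Pi.smul_apply, smul_eq_mul] at E₀ E₁ E₂
    simp only [eval_add, eval_sub, eval_mul, eval_pow, eval_zero, E₀, E₁, E₂, e₀, e₁]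
    ring
  obtain ⟨c, d, hd, hcd, hc⟩ := exists_factor_of_isCoprime h.isCoprime hf hquad
  -- degrees: `s₀ ^ 2` dominates `F₀`, so that `F₀ = f * d` is monic of degree `2 * (n + 1) ^ 2 + 2`
  have hs₀m : s₀.Monic := monic_X.mul hf₁
  have hs₀n : s₀.natDegree = (n + 1) ^ 2 + 1 := by
    rw [hs₀, monic_X.natDegree_mul hf₁, natDegree_X, hfn₁, add_comm]
  have hg₁' : g₁.natDegree ≤ (n + 1) ^ 2 - 1 := by
    by_cases hg : g₁ = 0
    · simp [hg]
    · have := (natDegree_lt_iff_degree_lt hg).mpr hgn₁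
      omega
  have hpos : 1 ≤ (n + 1) ^ 2 := Nat.one_le_pow _ _ n.succ_pos
  have hs₁n : s₁.natDegree ≤ (n + 1) ^ 2 := by
    refine (natDegree_add_le _ _).trans (max_le hfn₁.le ?_)
    refine natDegree_mul_le.trans ?_
    rw [natDegree_X]
    omega
  obtain ⟨N, hN⟩ : ∃ N, (n + 1) ^ 2 = N + 1 := ⟨_, (Nat.sub_add_cancel hpos).symm⟩
  rw [hN] at hs₀n hs₁n hg₁'
  simp only [Nat.add_sub_cancel] at hg₁'
  have hC (a : F) (p q : F[X]) {i j : ℕ} (hp : p.natDegree ≤ i) (hq : q.natDegree ≤ j) :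
      (C a * p * q).natDegree ≤ i + j :=
    natDegree_mul_le_of_le ((natDegree_C_mul_le _ _).trans hp) hq
  have hF₀m : F₀.Monic ∧ F₀.natDegree = 2 * (N + 2) := by
    set R : F[X] := -(C W.b₄ * s₀ * g₁) - C W.b₆ * s₁ * g₁ - C W.b₈ * g₁ ^ 2 with hR
    have e : F₀ = s₀ ^ 2 + R := by rw [hF₀, hR]; ring
    have hRd : R.natDegree < (s₀ ^ 2).natDegree := by
      rw [hs₀m.natDegree_pow, hs₀n]
      have a1 := hC W.b₄ s₀ g₁ hs₀n.le hg₁'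
      have a2 := hC W.b₆ s₁ g₁ hs₁n hg₁'
      have a3 := hC W.b₈ g₁ g₁ hg₁' hg₁'
      rw [mul_assoc, ← sq] at a3
      have b1 := natDegree_sub_le (-(C W.b₄ * s₀ * g₁) - C W.b₆ * s₁ * g₁) (C W.b₈ * g₁ ^ 2)
      have b2 := natDegree_sub_le (-(C W.b₄ * s₀ * g₁)) (C W.b₆ * s₁ * g₁)
      rw [natDegree_neg] at b2
      rw [← hR] at b1
      omega
    rw [e]
    refine ⟨(hs₀m.pow 2).add_of_left (degree_lt_degree hRd), ?_⟩
    rw [natDegree_add_eq_left_of_natDegree_lt hRd, hs₀m.natDegree_pow, hs₀n]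
  have hF₁d : F₁.natDegree < 2 * (N + 2) := by
    have a1 := hC 2 s₁ s₀ hs₁n hs₀n.le
    have a2 := hC W.b₂ s₀ g₁ hs₀n.le hg₁'
    have a3 := hC W.b₄ s₁ g₁ hs₁n hg₁'
    have a4 := hC W.b₆ g₁ g₁ hg₁' hg₁'
    rw [mul_assoc, ← sq] at a4
    have b1 := natDegree_add_le (C 2 * s₁ * s₀ + C W.b₂ * s₀ * g₁ + C W.b₄ * s₁ * g₁)
      (C W.b₆ * g₁ ^ 2)
    have b2 := natDegree_add_le (C 2 * s₁ * s₀ + C W.b₂ * s₀ * g₁) (C W.b₄ * s₁ * g₁)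
    have b3 := natDegree_add_le (C 2 * s₁ * s₀) (C W.b₂ * s₀ * g₁)
    rw [← hF₁] at b1
    omega
  have hNn : 2 * (N + 2) = n ^ 2 + (n + 2) ^ 2 := by linarith
  have hdm : d.Monic := by
    refine hf.of_mul_monic_left ?_
    rw [← hd]
    exact hF₀m.1
  have hdn : d.natDegree = (n + 2) ^ 2 := by
    have := hF₀m.2
    rw [hd, hf.natDegree_mul hdm, hfn, hNn] at this
    omega
  refine ⟨d, c, ?_, hdm, hdn, ?_⟩
  · intro x y hxy
    obtain ⟨z, hz, e⟩ := key x y hxy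
    obtain ⟨u, hu, e₀, e₁⟩ := h x y hxy
    have E₀ := congr_fun e 0
    have E₁ := congr_fun e 1
    have E₂ := congr_fun e 2
    have hb := xRep_ne_zero (n • some x y hxy)
    simp only [sym2x, Matrix.cons_val, Pi.smul_apply, smul_eq_mul, hd, hcd, hc, eval_add,
      eval_mul, e₀, e₁] at E₀ E₁ E₂
    refine ⟨z / u, div_ne_zero hz hu, ?_⟩
    generalize (n • some x y hxy).xRep = b at *
    generalize ((n + 2) • some x y hxy).xRep = a at *
    -- now cancel the nonzero linear form attached to `n • P`
    rw [div_mul_eq_mul_div, div_mul_eq_mul_div, eq_div_iff hu, eq_div_iff hu]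
    by_cases h0 : b 0 = 0
    · have h1 : b 1 ≠ 0 := fun h1 ↦ hb (by ext i; fin_cases i <;> assumption)
      rw [h0] at E₁
      exact ⟨mul_right_cancel₀ h1 (by linear_combination E₁),
        mul_right_cancel₀ h1 (by linear_combination E₂)⟩
    · have hp : eval x d * u = z * a 0 := mul_right_cancel₀ h0 (by linear_combination E₀)
      exact ⟨hp, mul_right_cancel₀ h0 (by linear_combination E₁ - b 1 * hp)⟩
  · have e : c * f = F₁ - d * g := by rw [hcd]; ring
    have hlt : (c * f).degree < ((n + 2) ^ 2 : ℕ) + (n ^ 2 : ℕ) := by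
      rw [e]
      refine (degree_sub_le _ _).trans_lt (max_lt ?_ ?_)
      · refine degree_le_natDegree.trans_lt ?_
        rw [← Nat.cast_add, Nat.cast_lt]
        omega
      · rw [degree_mul, degree_eq_natDegree hdm.ne_zero, hdn]
        exact WithBot.add_lt_add_left (WithBot.natCast_ne_bot _) hgn
    rw [degree_mul, degree_eq_natDegree hf.ne_zero, hfn] at hlt
    exact lt_of_add_lt_add_right hlt

/-- Multiplication by `n` is given on `x`-coordinates by a fraction `f / g` in lowest terms, where
`f` is monic of degree `n²` and `g` has smaller degree. -/
theorem exists_isXMul (W : Affine F) [IsAlgClosed F] [W.IsElliptic] (n : ℕ) :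
    ∃ f g : F[X], IsXMul W n f g ∧ f.Monic ∧ f.natDegree = n ^ 2 ∧ g.degree < (n ^ 2 : ℕ) := by
  induction n using Nat.twoStepInduction with
  | zero => exact ⟨1, 0, isXMul_zero, monic_one, by simp, by simp⟩
  | one => exact ⟨X, 1, isXMul_one, monic_X, by simp, by simp⟩
  | more n ih ih₁ =>
    obtain ⟨f, g, h, hf, hfn, hgn⟩ := ih
    obtain ⟨f₁, g₁, h₁, hf₁, hfn₁, hgn₁⟩ := ih₁
    exact h.exists_succ_succ hf hfn hgn h₁ hf₁ hfn₁ hgn₁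

end WeierstrassCurve.Affine

/-! ### Counting torsion points -/

namespace WeierstrassCurve.Affine

open Polynomial Point

variable {F : Type*} [Field F] [DecidableEq F] {W : Affine F} {n : ℕ} {f g : F[X]}

theorem IsXMul.nsmul_eq_or_eq_neg (h : IsXMul W n f g) {x y c d : F} (hxy : W.Nonsingular x y)
    (hcd : W.Nonsingular c d) (hx : f.eval x = c * g.eval x) :
    n • some x y hxy = some c d hcd ∨ n • some x y hxy = -some c d hcd := by
  obtain ⟨u, hu, e₀, e₁⟩ := h x y hxy
  rw [e₀, e₁, mul_left_comm] at hx
  have hx := mul_left_cancel₀ hu hx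
  generalize n • some x y hxy = Q at *
  rcases Q with _ | ⟨x', y', h'⟩
  · change (1 : F) = c * 0 at hx
    simp at hx
  · simp only [xRep_some, Matrix.cons_val, mul_one] at hx
    exact X_eq_iff.mp hx

omit [DecidableEq F] in
theorem degree_fiber_polynomial (hf : f.Monic) (hfn : f.natDegree = n ^ 2)
    (hgn : g.degree < (n ^ 2 : ℕ)) (c : F) :
    (f - C c * g).natDegree = n ^ 2 ∧ f - C c * g ≠ 0 := by
  have hd : f.degree = (n ^ 2 : ℕ) := by rw [degree_eq_natDegree hf.ne_zero, hfn]
  have hlt : (C c * g).degree < f.degree := by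
    rw [← smul_eq_C_mul, hd]
    exact (degree_smul_le c g).trans_lt hgn
  have := hf.sub_of_left hlt
  refine ⟨?_, this.ne_zero⟩
  rw [← hfn]
  exact natDegree_eq_of_degree_eq (degree_sub_eq_left_of_degree_lt hlt)

theorem nsmul_surjective [IsAlgClosed F] [W.IsElliptic] (hn : n ≠ 0) :
    Function.Surjective fun P : W.Point ↦ n • P := by
  intro R
  rcases R with _ | ⟨c, d, hcd⟩
  · exact ⟨0, smul_zero n⟩
  obtain ⟨f, g, h, hf, hfn, hgn⟩ := exists_isXMul W n
  obtain ⟨hdeg, hne⟩ := degree_fiber_polynomial hf hfn hgn c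
  obtain ⟨x, hx⟩ := IsAlgClosed.exists_root (f - C c * g) (by
    rw [degree_eq_natDegree hne, hdeg]
    exact_mod_cast pow_ne_zero 2 hn)
  obtain ⟨y, hxy⟩ := exists_nonsingular (W := W) x
  rw [IsRoot.def, eval_sub, eval_mul, eval_C, sub_eq_zero] at hx
  rcases h.nsmul_eq_or_eq_neg hxy hcd hx with e | e
  · exact ⟨_, e⟩
  · exact ⟨-some x y hxy, by simp only [smul_neg, e, neg_neg]⟩

theorem IsXMul.ne_zero_right [IsAlgClosed F] [W.IsElliptic] (h : IsXMul W n f g)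
    (hf : f.Monic) (hfn : f.natDegree = n ^ 2) (hn : n ≠ 0) : g ≠ 0 := by
  rintro rfl
  have h1 := hf.eq_one_of_isUnit (isCoprime_zero_right.mp h.isCoprime)
  rw [h1, natDegree_one] at hfn
  exact pow_ne_zero 2 hn hfn.symm

omit [DecidableEq F] in
theorem wronskian_ne_zero_of_isCoprime [CharZero F] (h : IsCoprime f g) (hg : g ≠ 0)
    (hf : f.natDegree ≠ 0) : wronskian f g ≠ 0 := by
  intro hW
  rw [wronskian, sub_eq_zero] at hW
  have hg' : derivative g = 0 := by
    by_contra hne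
    have hdvd : g ∣ derivative g :=
      h.symm.dvd_of_dvd_mul_left ⟨derivative f, by rw [hW, mul_comm]⟩
    exact (degree_derivative_lt hg).not_ge (degree_le_of_dvd hdvd hne)
  rw [hg', mul_zero, eq_comm, mul_eq_zero, or_iff_left hg] at hW
  exact hf (derivative_eq_zero.mp hW)

/-- Multiplication by `n` has a fibre with `n²` elements: on `x`-coordinates a general fibre consists
of `n²` values, and above each of them exactly one of `P` and `-P` lies in the fibre. -/
theorem exists_ncard_fiber_nsmul [IsAlgClosed F] [CharZero F] [W.IsElliptic] (hn : n ≠ 0) :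
    ∃ R : W.Point, {P : W.Point | n • P = R}.ncard = n ^ 2 := by
  obtain ⟨f, g, h, hf, hfn, hgn⟩ := exists_isXMul W n
  obtain ⟨f₂, g₂, h₂, hf₂, hfn₂, -⟩ := exists_isXMul W 2
  have hg := h.ne_zero_right hf hfn hn
  have hW := wronskian_ne_zero_of_isCoprime h.isCoprime hg (by rw [hfn]; exact pow_ne_zero 2 hn)
  have hg₂ := h₂.ne_zero_right hf₂ hfn₂ two_ne_zero
  -- avoid the critical values of `f / g` and the `x`-coordinates of the points of order two
  obtain ⟨c, hc⟩ := Infinite.exists_notMem_finset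
    (((wronskian f g).roots.toFinset.image fun x ↦ f.eval x / g.eval x) ∪ g₂.roots.toFinset)
  obtain ⟨d, hcd⟩ := exists_nonsingular (W := W) c
  simp only [Finset.mem_union, Finset.mem_image, Multiset.mem_toFinset, mem_roots hW,
    mem_roots hg₂, not_or, not_exists, not_and, IsRoot.def] at hc
  obtain ⟨hcW, hc₂⟩ := hc
  have hne : some c d hcd ≠ -some c d hcd := by
    intro e
    have e2 : 2 • some c d hcd = 0 := by rw [two_smul]; nth_rw 2 [e]; exact add_neg_cancel _
    obtain ⟨u, hu, -, e₁⟩ := h₂ c d hcd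
    rw [e2] at e₁
    exact hc₂ (by simpa using e₁)
  obtain ⟨hdeg, hp0⟩ := degree_fiber_polynomial hf hfn hgn c
  set p := f - C c * g with hp
  have hroot (x : F) : x ∈ p.roots.toFinset ↔ f.eval x = c * g.eval x := by
    rw [Multiset.mem_toFinset, mem_roots hp0, IsRoot.def, hp, eval_sub, eval_mul, eval_C,
      sub_eq_zero]
  -- by coprimality `f` and `g` have no common root
  have hgx (x : F) (hx : f.eval x = c * g.eval x) : g.eval x ≠ 0 := by
    intro h0
    have := (Polynomial.isCoprime_iff_aeval_ne_zero_of_isAlgClosed F F f g).mp h.isCoprime x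
    simp only [coe_aeval_eq_eval] at this
    rw [h0, mul_zero] at hx
    tauto
  have hnodup : p.roots.Nodup := by
    refine nodup_roots ?_
    rw [Polynomial.separable_def, Polynomial.isCoprime_iff_aeval_ne_zero_of_isAlgClosed F F]
    intro x
    simp only [coe_aeval_eq_eval]
    by_contra! hx
    obtain ⟨hx, hx'⟩ := hx
    have hx0 : f.eval x = c * g.eval x := by
      rwa [hp, eval_sub, eval_mul, eval_C, sub_eq_zero] at hx
    have hx1 : (derivative f).eval x = c * (derivative g).eval x := by
      rwa [hp, derivative_sub, derivative_C_mul, eval_sub, eval_mul, eval_C, sub_eq_zero] at hx'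
    refine hcW x ?_ (by rw [hx0, mul_div_cancel_right₀ _ (hgx x hx0)])
    rw [wronskian, eval_sub, eval_mul, eval_mul, hx0, hx1]
    ring
  have hcard : p.roots.toFinset.card = n ^ 2 := by
    rw [Multiset.toFinset_card_of_nodup hnodup, ← hdeg]
    exact (IsAlgClosed.splits p).natDegree_eq_card_roots.symm
  refine ⟨some c d hcd, ?_⟩
  have hinj : Set.InjOn (fun P : W.Point ↦ P.xRep 0) {P : W.Point | n • P = some c d hcd} := by
    rintro P hP Q hQ hPQ
    simp only [Set.mem_ofPred_eq] at hP hQ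
    rcases P with _ | ⟨x, y, hxy⟩
    · exact absurd hP (by rw [← zero_def, smul_zero]; exact (some_ne_zero hcd).symm)
    rcases Q with _ | ⟨x', y', hxy'⟩
    · exact absurd hQ (by rw [← zero_def, smul_zero]; exact (some_ne_zero hcd).symm)
    rcases X_eq_iff.mp hPQ with e | e
    · exact e
    · refine absurd ?_ hne
      calc some c d hcd = n • some x y hxy := hP.symm
        _ = n • -some x' y' hxy' := congrArg _ e
        _ = -some c d hcd := by rw [smul_neg, hQ]
  rw [← hcard, ← Set.ncard_coe_finset, ← hinj.ncard_image]
  congr 1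
  ext x
  simp only [Set.mem_image, Set.mem_ofPred_eq, SetLike.mem_coe, hroot]
  constructor
  · rintro ⟨P, hP, rfl⟩
    rcases P with _ | ⟨x, y, hxy⟩
    · exact absurd hP (by rw [← zero_def, smul_zero]; exact (some_ne_zero hcd).symm)
    obtain ⟨u, hu, e₀, e₁⟩ := h x y hxy
    simp only [hP, xRep_some, Matrix.cons_val] at e₀ e₁ ⊢
    rw [e₀, e₁]
    ring
  · intro hx
    obtain ⟨y, hxy⟩ := exists_nonsingular (W := W) x
    rcases h.nsmul_eq_or_eq_neg hxy hcd hx with e | e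
    · exact ⟨_, e, by simp⟩
    · exact ⟨-some x y hxy, by simp only [smul_neg, e, neg_neg], by rw [xRep_neg]; simp⟩

/-- The `n`-torsion of an elliptic curve over an algebraically closed field of characteristic zero
has `n²` elements. -/
theorem ncard_nsmul_eq_zero [IsAlgClosed F] [CharZero F] [W.IsElliptic] (hn : n ≠ 0) :
    {P : W.Point | n • P = 0}.ncard = n ^ 2 := by
  obtain ⟨R, hR⟩ := exists_ncard_fiber_nsmul (W := W) hn
  obtain ⟨P₀, hP₀⟩ := nsmul_surjective (W := W) hn R
  rw [← hR, ← Set.ncard_image_of_injective _ (add_right_injective P₀)]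
  congr 1
  ext P
  simp only at hP₀
  simp only [Set.mem_image, Set.mem_ofPred_eq]
  constructor
  · rintro ⟨Q, hQ, rfl⟩
    rw [smul_add, hP₀, hQ, add_zero]
  · intro hP
    exact ⟨P - P₀, by rw [smul_sub, hP, hP₀, sub_self], by abel⟩

end WeierstrassCurve.Affine

/-! ### Abelian groups with the torsion of an elliptic curve -/

namespace EllQ

variable {A : Type*} [AddCommGroup A] {n : ℕ}

/-- A divisible abelian group `A` such that `A[n]` has `n²` elements for every `n ≠ 0`, like the
group of points of an elliptic curve over an algebraically closed field of characteristic zero. -/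
structure HasTorsionRankTwo (A : Type*) [AddCommGroup A] : Prop where
  exists_nsmul_eq : ∀ {n : ℕ}, n ≠ 0 → ∀ P : A, ∃ Q, n • Q = P
  ncard_eq : ∀ {n : ℕ}, n ≠ 0 → {P : A | n • P = 0}.ncard = n ^ 2

/-- The points `P` and `Q` satisfy no linear relations except those with coefficients divisible
by `n`. -/
def IndepPair (n : ℕ) (P Q : A) : Prop :=
  ∀ a b : ℤ, a • P + b • Q = 0 → (n : ℤ) ∣ a ∧ (n : ℤ) ∣ b

variable {ℓ : ℕ}

/-- Independence of points of `ℓ`-power order can be tested on their multiples of order `ℓ`. -/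
theorem IndepPair.of_pow_smul {P Q : A}
    (h : IndepPair ℓ (ℓ ^ n • P) (ℓ ^ n • Q)) : IndepPair (ℓ ^ (n + 1)) P Q := by
  intro a b hab
  suffices H : ∀ k ≤ n + 1, ((ℓ ^ k : ℕ) : ℤ) ∣ a ∧ ((ℓ ^ k : ℕ) : ℤ) ∣ b from H _ le_rfl
  intro k
  induction k with
  | zero => simp
  | succ k ih =>
    intro hk
    obtain ⟨⟨a', rfl⟩, b', rfl⟩ := ih (by omega)
    obtain ⟨ha, hb⟩ := h a' b' (by
      have := congrArg (ℓ ^ (n - k) • ·) hab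
      simp only [smul_zero, smul_add] at this
      rw [← this]
      have e : ℓ ^ n = ℓ ^ (n - k) * ℓ ^ k := by rw [← pow_add, Nat.sub_add_cancel (by omega)]
      simp only [← natCast_zsmul, smul_smul, e]
      push_cast
      congr 2 <;> ring)
    push_cast at *
    rw [pow_succ]
    exact ⟨mul_dvd_mul_left _ ha, mul_dvd_mul_left _ hb⟩

theorem addOrderOf_eq_of_nsmul_pow (hℓ : ℓ.Prime) {P : A}
    (h : ℓ ^ n • P ≠ 0) (h' : ℓ ^ (n + 1) • P = 0) : addOrderOf P = ℓ ^ (n + 1) := by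
  have := Fact.mk hℓ
  exact addOrderOf_eq_prime_pow h h'

/-- Every point of order `ℓ` belongs to a basis of the `ℓ`-torsion. -/
theorem exists_indepPair_prime (hA : HasTorsionRankTwo A) (hℓ : ℓ.Prime) {Q : A} (hQ : Q ≠ 0)
    (hQℓ : ℓ • Q = 0) : ∃ P : A, ℓ • P = 0 ∧ IndepPair ℓ P Q := by
  have hcardℓ := hA.ncard_eq hℓ.ne_zero
  have hord : addOrderOf Q = ℓ := by
    have := Fact.mk hℓ
    exact addOrderOf_eq_prime hQℓ hQ
  obtain ⟨P, hP, hPQ⟩ : ∃ P : A, ℓ • P = 0 ∧ P ∉ AddSubgroup.zmultiples Q := by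
    by_contra! hall
    have hz : (AddSubgroup.zmultiples Q : Set A).ncard = ℓ := by
      rw [← Nat.card_coe_set_eq]
      exact (Nat.card_zmultiples Q).trans hord
    have hfin : (AddSubgroup.zmultiples Q : Set A).Finite :=
      Set.finite_of_ncard_ne_zero (hz.trans_ne hℓ.ne_zero)
    have hle := Set.ncard_le_ncard (s := {P : A | ℓ • P = 0}) hall hfin
    rw [hcardℓ, hz] at hle
    nlinarith [hℓ.one_lt]
  refine ⟨P, hP, fun a b hab ↦ ?_⟩
  have ha : (ℓ : ℤ) ∣ a := by
    by_contra hna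
    have hcop : IsCoprime (ℓ : ℤ) a :=
      (Nat.prime_iff_prime_int.mp hℓ).coprime_iff_not_dvd.mpr hna
    obtain ⟨u, v, huv⟩ := hcop
    refine hPQ (AddSubgroup.mem_zmultiples_iff.mpr ⟨-(v * b), ?_⟩)
    calc (-(v * b)) • Q = v • (a • P) - v • (a • P + b • Q) := by
          rw [smul_add, smul_smul v b, neg_smul]; abel
      _ = (u * ℓ + v * a) • P := by
          rw [hab, smul_zero, sub_zero, add_smul, mul_smul u, natCast_zsmul, hP, smul_zero,
            zero_add, mul_smul]
      _ = P := by rw [huv, one_smul]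
  refine ⟨ha, ?_⟩
  obtain ⟨a', rfl⟩ := ha
  rw [mul_comm, mul_smul, natCast_zsmul, hP, smul_zero, zero_add] at hab
  rw [← hord]
  exact addOrderOf_dvd_iff_zsmul_eq_zero.mpr hab

/-- Every point of order `ℓ ^ n` belongs to a basis of the `ℓ ^ n`-torsion. -/
theorem exists_indepPair_pow (hA : HasTorsionRankTwo A) (hℓ : ℓ.Prime) {Q : A}
    (hQ : addOrderOf Q = ℓ ^ n) :
    ∃ P : A, ℓ ^ n • P = 0 ∧ IndepPair (ℓ ^ n) P Q := by
  cases n with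
  | zero => exact ⟨0, smul_zero _, fun a b _ ↦ by simp⟩
  | succ n =>
    obtain ⟨J, hJ, hJQ⟩ := exists_indepPair_prime hA hℓ (Q := ℓ ^ n • Q) (fun h0 ↦ by
        have := Nat.le_of_dvd (pow_pos hℓ.pos n) (hQ ▸ addOrderOf_dvd_of_nsmul_eq_zero h0)
        exact this.not_gt (Nat.pow_lt_pow_succ hℓ.one_lt))
      (by rw [smul_smul, ← pow_succ', ← hQ, addOrderOf_nsmul_eq_zero])
    obtain ⟨P, rfl⟩ := hA.exists_nsmul_eq (pow_ne_zero n hℓ.ne_zero) J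
    exact ⟨P, by rw [pow_succ', mul_smul, hJ], hJQ.of_pow_smul⟩

theorem exists_ne_zero_nsmul_eq_zero (hA : HasTorsionRankTwo A) (hℓ : ℓ.Prime) :
    ∃ Q : A, Q ≠ 0 ∧ ℓ • Q = 0 := by
  have hcard := hA.ncard_eq hℓ.ne_zero
  obtain ⟨Q, hQ, hQ0⟩ := Set.exists_ne_of_one_lt_ncard
    (hcard ▸ Nat.one_lt_pow two_ne_zero hℓ.one_lt : 1 < {P : A | ℓ • P = 0}.ncard) 0
  exact ⟨Q, hQ0, hQ⟩

/-- A point of order `ℓ ^ r` is divisible by `ℓ ^ m` with a quotient of order `ℓ ^ (m + r)`. -/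
theorem exists_pow_smul_eq_addOrderOf (hA : HasTorsionRankTwo A) (hℓ : ℓ.Prime) {K : A} {r : ℕ}
    (hK : addOrderOf K = ℓ ^ r) (m : ℕ) :
    ∃ Q : A, ℓ ^ m • Q = K ∧ addOrderOf Q = ℓ ^ (m + r) := by
  cases r with
  | zero =>
    obtain rfl : K = 0 := AddMonoid.addOrderOf_eq_one_iff.mp hK
    cases m with
    | zero => exact ⟨0, smul_zero _, by simp⟩
    | succ m =>
      obtain ⟨J, hJ, hJℓ⟩ := exists_ne_zero_nsmul_eq_zero hA hℓ
      obtain ⟨Q, rfl⟩ := hA.exists_nsmul_eq (pow_ne_zero m hℓ.ne_zero) J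
      have h0 : ℓ ^ (m + 1) • Q = 0 := by rw [pow_succ', mul_smul, hJℓ]
      exact ⟨Q, h0, addOrderOf_eq_of_nsmul_pow hℓ hJ h0⟩
  | succ r =>
    obtain ⟨Q, rfl⟩ := hA.exists_nsmul_eq (pow_ne_zero m hℓ.ne_zero) K
    refine ⟨Q, rfl, addOrderOf_eq_of_nsmul_pow hℓ (n := m + r) ?_ ?_⟩
    · intro h0
      rw [add_comm, pow_add, mul_smul] at h0
      have := Nat.le_of_dvd (pow_pos hℓ.pos r) (hK ▸ addOrderOf_dvd_of_nsmul_eq_zero h0)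
      exact this.not_gt (Nat.pow_lt_pow_succ hℓ.one_lt)
    · have : m + r + 1 = (r + 1) + m := by ring
      rw [this, pow_add, mul_smul, ← hK, addOrderOf_nsmul_eq_zero]

/-- Dividing a basis of `A[ℓ]` repeatedly by `ℓ` gives a compatible system of bases. -/
theorem exists_compatible_indepPair (hA : HasTorsionRankTwo A) (hℓ : ℓ.Prime) :
    ∃ p q : ℕ → A, (∀ k, ℓ • p (k + 1) = p k) ∧ (∀ k, ℓ • q (k + 1) = q k) ∧
      ∀ k, ℓ ^ k • p k = 0 ∧ ℓ ^ k • q k = 0 ∧ IndepPair (ℓ ^ k) (p k) (q k) := by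
  obtain ⟨J₁, hJ₁, hJ₁ℓ⟩ := exists_ne_zero_nsmul_eq_zero hA hℓ
  obtain ⟨J₀, hJ₀ℓ, hJ⟩ := exists_indepPair_prime hA hℓ hJ₁ hJ₁ℓ
  choose s hs using fun P : A ↦ hA.exists_nsmul_eq hℓ.ne_zero P
  have hiter (P : A) (k : ℕ) : ℓ ^ k • (s^[k] P) = P := by
    induction k with
    | zero => simp
    | succ k ih => rw [Function.iterate_succ_apply', pow_succ, mul_smul, hs, ih]
  have hz (P : A) (hP : ℓ • P = 0) (k : ℕ) : ℓ ^ k • ℓ • (s^[k] P) = 0 := by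
    rw [smul_comm, hiter, hP]
  refine ⟨fun k ↦ ℓ • (s^[k] J₀), fun k ↦ ℓ • (s^[k] J₁), fun k ↦ ?_, fun k ↦ ?_,
    fun k ↦ ⟨hz _ hJ₀ℓ k, hz _ hJ₁ℓ k, ?_⟩⟩
  · simp only [Function.iterate_succ_apply', hs]
  · simp only [Function.iterate_succ_apply', hs]
  · cases k with
    | zero => exact fun a b _ ↦ by simp
    | succ k =>
      refine IndepPair.of_pow_smul ?_
      simp only [smul_smul, ← pow_succ, hiter]
      exact hJ

/-! ### Bases of the torsion of an elliptic curve over the rationals -/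

section EllipticCurve

variable {E : WeierstrassCurve ℚ}

instance isElliptic_baseChange (E : WeierstrassCurve ℚ) [E.IsElliptic] :
    (E.baseChange QBar).IsElliptic :=
  inferInstanceAs (E.map (algebraMap ℚ QBar)).IsElliptic

theorem hasTorsionRankTwo (E : WeierstrassCurve ℚ) [E.IsElliptic] : HasTorsionRankTwo (Pts E) where
  exists_nsmul_eq hn P := WeierstrassCurve.Affine.nsmul_surjective hn P
  ncard_eq hn := WeierstrassCurve.Affine.ncard_nsmul_eq_zero hn

theorem mem_torsionBy {P : Pts E} :
    P ∈ AddSubgroup.torsionBy (Pts E) (n : ℤ) ↔ n • P = 0 :=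
  AddSubgroup.torsionBy.nsmul_iff

theorem nsmul_coe_tors (P : Tors E n) : n • (P : Pts E) = 0 := mem_torsionBy.mp P.2

theorem coe_intCast_smul (a : ℤ) (P : Tors E n) :
    (((a : ZMod n) • P : Tors E n) : Pts E) = a • (P : Pts E) := by
  rw [Int.cast_smul_eq_zsmul]
  rfl

theorem card_tors [E.IsElliptic] (hn : n ≠ 0) : Nat.card (Tors E n) = n ^ 2 := by
  rw [← (hasTorsionRankTwo E).ncard_eq hn, ← Nat.card_coe_set_eq]
  exact Nat.card_congr (Equiv.subtypeEquivRight fun P ↦ mem_torsionBy)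

theorem finite_tors [E.IsElliptic] (hn : n ≠ 0) : Finite (Tors E n) :=
  Nat.finite_of_card_ne_zero (by rw [card_tors hn]; exact pow_ne_zero 2 hn)

/-- Two independent `n`-torsion points form a basis of the `n`-torsion, because it has `n²`
elements. -/
theorem IndepPair.exists_basis [E.IsElliptic] (hn : n ≠ 0) {P Q : Pts E} (h : IndepPair n P Q)
    (hP : n • P = 0) (hQ : n • Q = 0) :
    ∃ b : Module.Basis (Fin 2) (ZMod n) (Tors E n), (b 0 : Pts E) = P ∧ (b 1 : Pts E) = Q := by
  have := NeZero.mk hn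
  have := finite_tors (E := E) hn
  let v : Fin 2 → Tors E n := ![⟨P, mem_torsionBy.mpr hP⟩, ⟨Q, mem_torsionBy.mpr hQ⟩]
  let L : (Fin 2 → ZMod n) →ₗ[ZMod n] Tors E n := Fintype.linearCombination (ZMod n) v
  have hinj : Function.Injective L := by
    rw [injective_iff_map_eq_zero]
    intro c hc
    obtain ⟨a, ha⟩ := ZMod.intCast_surjective (c 0)
    obtain ⟨b, hb⟩ := ZMod.intCast_surjective (c 1)
    rw [Fintype.linearCombination_apply, Fin.sum_univ_two, ← ha, ← hb] at hc
    have hc' := congrArg (Subtype.val) hc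
    rw [AddSubgroup.coe_add, coe_intCast_smul, coe_intCast_smul] at hc'
    obtain ⟨h0, h1⟩ := h a b hc'
    ext i
    fin_cases i
    · exact ha.symm.trans ((ZMod.intCast_zmod_eq_zero_iff_dvd a n).mpr h0)
    · exact hb.symm.trans ((ZMod.intCast_zmod_eq_zero_iff_dvd b n).mpr h1)
  have hbij : Function.Bijective L := by
    refine hinj.bijective_of_nat_card_le ?_
    rw [card_tors hn, Nat.card_fun, Nat.card_zmod, Nat.card_fin]
  refine ⟨.ofEquivFun (LinearEquiv.ofBijective L hbij).symm, ?_, ?_⟩ <;>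
    simp [L, v, Fintype.linearCombination_apply, Pi.single_apply]

theorem indepPair_basis (b : Module.Basis (Fin 2) (ZMod n) (Tors E n)) :
    IndepPair n (b 0 : Pts E) (b 1 : Pts E) := by
  intro x y h
  have h' : (x : ZMod n) • b 0 + (y : ZMod n) • b 1 = 0 := by
    apply Subtype.ext
    rw [AddSubgroup.coe_add, coe_intCast_smul, coe_intCast_smul]
    exact h
  have hli := Fintype.linearIndependent_iff.mp b.linearIndependent ![(x : ZMod n), (y : ZMod n)]
    (by rw [Fin.sum_univ_two]; exact h')
  exact ⟨(ZMod.intCast_zmod_eq_zero_iff_dvd x n).mp (hli 0),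
    (ZMod.intCast_zmod_eq_zero_iff_dvd y n).mp (hli 1)⟩

theorem exists_eq_zsmul_add_zsmul (b : Module.Basis (Fin 2) (ZMod n) (Tors E n)) {P : Pts E}
    (hP : n • P = 0) : ∃ x y : ℤ, P = x • (b 0 : Pts E) + y • (b 1 : Pts E) := by
  have h := b.sum_repr ⟨P, mem_torsionBy.mpr hP⟩
  obtain ⟨x, hx⟩ := ZMod.intCast_surjective (b.repr ⟨P, mem_torsionBy.mpr hP⟩ 0)
  obtain ⟨y, hy⟩ := ZMod.intCast_surjective (b.repr ⟨P, mem_torsionBy.mpr hP⟩ 1)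
  rw [Fin.sum_univ_two, ← hx, ← hy] at h
  refine ⟨x, y, ?_⟩
  rw [← coe_intCast_smul, ← coe_intCast_smul, ← AddSubgroup.coe_add, h]

theorem nonempty_tateBasis [E.IsElliptic] (hℓ : ℓ.Prime) : Nonempty (TateBasis ℓ E) := by
  obtain ⟨p, q, hp, hq, hpq⟩ := exists_compatible_indepPair (hasTorsionRankTwo E) hℓ
  choose b hb₀ hb₁ using fun k ↦
    (hpq k).2.2.exists_basis (pow_ne_zero k hℓ.ne_zero) (hpq k).1 (hpq k).2.1
  refine ⟨⟨b, fun k i ↦ ?_⟩⟩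
  fin_cases i
  · change ℓ • (b (k + 1) 0 : Pts E) = (b k 0 : Pts E)
    rw [hb₀, hb₀, hp]
  · change ℓ • (b (k + 1) 1 : Pts E) = (b k 1 : Pts E)
    rw [hb₁, hb₁, hq]

end EllipticCurve

end EllQ

/-! ### The primary part of a finite cyclic kernel -/

namespace EllQ

section Group

variable {A A' : Type*} [AddCommGroup A] [AddCommGroup A'] {ℓ : ℕ}

/-- The `ℓ`-primary part of a finite cyclic group of order exactly divisible by `ℓ ^ r` is
generated by an element of order `ℓ ^ r`. -/
theorem exists_generator_primary (hℓ : ℓ.Prime) (H : AddSubgroup A) [Finite H] [IsAddCyclic H]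
    {r : ℕ} (hr : ℓ ^ r ∣ Nat.card H) (hr' : ¬ ℓ ^ (r + 1) ∣ Nat.card H) :
    ∃ K ∈ H, addOrderOf K = ℓ ^ r ∧
      ∀ x ∈ H, ∀ k : ℕ, ℓ ^ k • x = 0 → ∃ j : ℤ, x = j • K := by
  obtain ⟨g, hg⟩ := IsAddCyclic.exists_generator (α := H)
  have hgord : addOrderOf (g : A) = Nat.card H := by
    rw [AddSubgroup.addOrderOf_coe, addOrderOf_eq_card_of_forall_mem_zmultiples hg]
  obtain ⟨N, hN⟩ := hr
  have hℓN : Nat.Coprime ℓ N := by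
    rw [Nat.Prime.coprime_iff_not_dvd hℓ]
    rintro ⟨M, rfl⟩
    exact hr' ⟨M, by rw [hN]; ring⟩
  have hN0 : N ≠ 0 := by
    rintro rfl
    exact Nat.card_pos.ne' hN
  refine ⟨N • (g : A), H.nsmul_mem g.2 N, ?_, ?_⟩
  · rw [addOrderOf_nsmul_of_dvd hN0 (by rw [hgord, hN]; exact dvd_mul_left _ _), hgord, hN,
      Nat.mul_div_cancel _ (Nat.pos_of_ne_zero hN0)]
  · intro x hx k hk
    obtain ⟨i, hi⟩ := AddSubgroup.mem_zmultiples_iff.mp (hg ⟨x, hx⟩)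
    have hi' : i • (g : A) = x := congrArg Subtype.val hi
    have hdvd : ((ℓ ^ r * N : ℕ) : ℤ) ∣ (ℓ ^ k : ℕ) * i := by
      rw [← hN, ← hgord]
      refine addOrderOf_dvd_iff_zsmul_eq_zero.mpr ?_
      rw [mul_smul, hi', natCast_zsmul, hk]
    have hNi : (N : ℤ) ∣ i := by
      refine IsCoprime.dvd_of_dvd_mul_left (y := ((ℓ ^ k : ℕ) : ℤ)) ?_
        ((Int.natCast_dvd_natCast.mpr (dvd_mul_left N (ℓ ^ r))).trans hdvd)
      exact Nat.isCoprime_iff_coprime.mpr (hℓN.pow_left k).symm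
    obtain ⟨j, rfl⟩ := hNi
    exact ⟨j, by rw [← hi', mul_comm, mul_smul, natCast_zsmul]⟩

/-- If `ℓ ^ m • Q` generates the `ℓ`-primary part of the kernel of `φ`, then `φ (ℓ ^ r • P)` and
`φ Q` are independent modulo `ℓ ^ m`. -/
theorem IndepPair.map (hℓ : ℓ.Prime) (φ : A →+ A') {m r : ℕ} {P Q : A}
    (h : IndepPair (ℓ ^ (m + r)) P Q) (hP : ℓ ^ (m + r) • P = 0) (hQ : ℓ ^ (m + r) • Q = 0)
    (hK : ∀ x, φ x = 0 → ∀ k : ℕ, ℓ ^ k • x = 0 → ∃ j : ℤ, x = j • (ℓ ^ m • Q)) :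
    IndepPair (ℓ ^ m) (φ (ℓ ^ r • P)) (φ Q) := by
  intro a b hab
  obtain ⟨j, hj⟩ := hK (a • (ℓ ^ r • P) + b • Q)
    (by rw [map_add, map_zsmul, map_zsmul, hab]) (m + r) (by
      rw [smul_add, smul_comm _ a, smul_comm _ b, hQ, smul_comm _ (ℓ ^ r) P, hP]
      simp)
  have hrel : (a * (ℓ ^ r : ℕ)) • P + (b - j * (ℓ ^ m : ℕ)) • Q = 0 := by
    rw [sub_smul, mul_smul, mul_smul, natCast_zsmul, natCast_zsmul, ← hj]
    abel
  obtain ⟨h1, h2⟩ := h _ _ hrel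
  have hne : ((ℓ ^ r : ℕ) : ℤ) ≠ 0 := by exact_mod_cast pow_ne_zero r hℓ.ne_zero
  have hdvd : ((ℓ ^ m : ℕ) : ℤ) ∣ ((ℓ ^ (m + r) : ℕ) : ℤ) :=
    Int.natCast_dvd_natCast.mpr (pow_dvd_pow _ (Nat.le_add_right m r))
  constructor
  · rw [pow_add, Nat.cast_mul] at h1
    exact (mul_dvd_mul_iff_right hne).mp h1
  · have := dvd_add (hdvd.trans h2) (dvd_mul_left ((ℓ ^ m : ℕ) : ℤ) j)
    rwa [sub_add_cancel] at this

/-- If `ℓ ^ m • Q'` is a multiple of `ℓ ^ m • Q`, the coefficient of `P` in `Q'` is divisible by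
`ℓ ^ r`. In the application `Q' = σ Q`, and `ℓ ^ m • Q` spans a Galois stable group. -/
theorem IndepPair.pow_dvd_coeff (hℓ : ℓ.Prime) {m r : ℕ} {P Q Q' : A}
    (h : IndepPair (ℓ ^ (m + r)) P Q) {C D j : ℤ} (hQ' : Q' = C • P + D • Q)
    (hj : ℓ ^ m • Q' = j • (ℓ ^ m • Q)) : (ℓ : ℤ) ^ r ∣ C := by
  have hrel : ((ℓ ^ m : ℕ) * C) • P + ((ℓ ^ m : ℕ) * D - j * (ℓ ^ m : ℕ)) • Q = 0 := by
    rw [sub_smul, mul_smul, mul_smul, mul_smul, natCast_zsmul, natCast_zsmul, natCast_zsmul, ← hj,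
      hQ', smul_add]
    abel
  have h1 := (h _ _ hrel).1
  have hne : ((ℓ ^ m : ℕ) : ℤ) ≠ 0 := by exact_mod_cast pow_ne_zero m hℓ.ne_zero
  rw [pow_add, Nat.cast_mul] at h1
  exact_mod_cast (mul_dvd_mul_iff_left hne).mp h1

end Group

/-! ### Galois equivariance of isogenies and matrices in adapted bases -/

section EllipticCurve

variable {E E' : WeierstrassCurve ℚ}

theorem eq_of_projCoords_eq {P Q : Pts E} {u : QBar} (hu : u ≠ 0)
    (h : ∀ i, projCoords P i = u * projCoords Q i) : P = Q := by
  have h0 := h 0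
  have h1 := h 1
  have h2 := h 2
  rcases P with _ | ⟨x, y, hP⟩ <;> rcases Q with _ | ⟨x', y', hQ⟩
  · rfl
  · exact absurd (by simpa [projCoords] using h2.symm) hu
  · simp [projCoords] at h2
  · simp only [projCoords, Matrix.cons_val, mul_one] at h0 h1 h2
    rw [← h2, one_mul] at h0 h1
    subst h0 h1
    rfl

theorem projCoords_galAct (σ : GQ) (P : Pts E) (i : Fin 3) :
    projCoords (galAct E σ P) i = σ (projCoords P i) := by
  rcases P with _ | ⟨x, y, h⟩
  · change projCoords (.zero : Pts E) i = _
    fin_cases i <;> simp [projCoords]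
  · change ![σ x, σ y, 1] i = σ (![x, y, 1] i)
    fin_cases i <;> simp

theorem aeval_projCoords_galAct (σ : GQ) (P : Pts E) (F : MvPolynomial (Fin 3) ℚ) :
    MvPolynomial.aeval (projCoords (galAct E σ P)) F =
      σ (MvPolynomial.aeval (projCoords P) F) := by
  have : projCoords (galAct E σ P) = fun i ↦ (σ : QBar →ₐ[ℚ] QBar) (projCoords P i) :=
    funext fun i ↦ projCoords_galAct σ P i
  rw [this]
  exact (MvPolynomial.comp_aeval_apply (projCoords P) (σ : QBar →ₐ[ℚ] QBar) F).symm

/-- An isogeny over `ℚ` commutes with the Galois action, because the polynomials that represent it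
have rational coefficients. -/
theorem Isogeny.toHom_galAct (φ : Isogeny E E') (σ : GQ) (P : Pts E) :
    φ.toHom (galAct E σ P) = galAct E' σ (φ.toHom P) := by
  obtain ⟨d, F, -, ⟨i, hi⟩, hF⟩ := φ.isMorphism P
  obtain ⟨u, hu, h⟩ := hF P ⟨i, hi⟩
  obtain ⟨v, hv, h'⟩ := hF (galAct E σ P)
    ⟨i, by rw [aeval_projCoords_galAct]; exact (map_ne_zero σ).mpr hi⟩
  refine eq_of_projCoords_eq (u := v⁻¹ * σ u)
    (mul_ne_zero (inv_ne_zero hv) ((map_ne_zero σ).mpr hu)) fun i ↦ ?_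
  rw [projCoords_galAct, mul_assoc, ← map_mul, ← h, ← aeval_projCoords_galAct, h',
    inv_mul_cancel_left₀ hv]

/-- Coordinates of the images of the basis vectors under `σ` give the matrix of `σ`. -/
theorem coe_modRep_eq {n : ℕ} (b : Module.Basis (Fin 2) (ZMod n) (Tors E n)) (σ : GQ)
    {A B C D : ℤ}
    (h₀ : galAct E σ (b 0 : Pts E) = A • (b 0 : Pts E) + B • (b 1 : Pts E))
    (h₁ : galAct E σ (b 1 : Pts E) = C • (b 0 : Pts E) + D • (b 1 : Pts E)) :
    (modRep E n b σ : Matrix (Fin 2) (Fin 2) (ZMod n)) =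
      !![(A : ZMod n), (C : ZMod n); (B : ZMod n), (D : ZMod n)] := by
  have h (i j : Fin 2) : (modRep E n b σ : Matrix (Fin 2) (Fin 2) (ZMod n)) i j =
      b.repr (torsAct E n σ (b j)) i := LinearMap.toMatrixAlgEquiv_apply _ _ _ _
  have e₀ : torsAct E n σ (b 0) = (A : ZMod n) • b 0 + (B : ZMod n) • b 1 := by
    apply Subtype.ext
    rw [coe_torsAct, AddSubgroup.coe_add, coe_intCast_smul, coe_intCast_smul, h₀]
  have e₁ : torsAct E n σ (b 1) = (C : ZMod n) • b 0 + (D : ZMod n) • b 1 := by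
    apply Subtype.ext
    rw [coe_torsAct, AddSubgroup.coe_add, coe_intCast_smul, coe_intCast_smul, h₁]
  ext i j
  rw [h]
  fin_cases j <;> fin_cases i <;> simp [e₀, e₁]

/-- The Galois matrices of `E` and `E'` in a basis `P, Q` such that `ℓ ^ m • Q` generates the
`ℓ`-primary part of the kernel, and in its image `φ (ℓ ^ r • P), φ Q`. -/
theorem exists_bases_modRep [E.IsElliptic] [E'.IsElliptic]
    (φ : Isogeny E E') [Finite φ.ker] [IsAddCyclic φ.ker] {ℓ : ℕ} (hℓ : ℓ.Prime) {r : ℕ}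
    (hr : ℓ ^ r ∣ Nat.card φ.ker) (hr' : ¬ ℓ ^ (r + 1) ∣ Nat.card φ.ker) (m : ℕ) :
    ∃ (b : Module.Basis (Fin 2) (ZMod (ℓ ^ (m + r))) (Tors E (ℓ ^ (m + r))))
      (b' : Module.Basis (Fin 2) (ZMod (ℓ ^ m)) (Tors E' (ℓ ^ m))),
      (b' 0 : Pts E') = φ.toHom (ℓ ^ r • (b 0 : Pts E)) ∧
      (b' 1 : Pts E') = φ.toHom (b 1 : Pts E) ∧
      ∀ σ : GQ, ∃ A B C D : ℤ,
        (modRep E (ℓ ^ (m + r)) b σ : Matrix (Fin 2) (Fin 2) (ZMod (ℓ ^ (m + r)))) =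
          !![(A : ZMod (ℓ ^ (m + r))), (C : ZMod (ℓ ^ (m + r)));
             (B : ZMod (ℓ ^ (m + r))), (D : ZMod (ℓ ^ (m + r)))] ∧
        (ℓ : ℤ) ^ r ∣ C ∧
        (modRep E' (ℓ ^ m) b' σ : Matrix (Fin 2) (Fin 2) (ZMod (ℓ ^ m))) =
          !![(A : ZMod (ℓ ^ m)), ((C / (ℓ : ℤ) ^ r : ℤ) : ZMod (ℓ ^ m));
             (((ℓ : ℤ) ^ r * B : ℤ) : ZMod (ℓ ^ m)), (D : ZMod (ℓ ^ m))] := by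
  obtain ⟨K, hKker, hKord, hK⟩ := exists_generator_primary hℓ φ.ker hr hr'
  obtain ⟨Q, hQK, hQord⟩ := exists_pow_smul_eq_addOrderOf (hasTorsionRankTwo E) hℓ hKord m
  obtain ⟨P, hP, hPQ⟩ := exists_indepPair_pow (hasTorsionRankTwo E) hℓ hQord
  have hQ : ℓ ^ (m + r) • Q = 0 := hQord ▸ addOrderOf_nsmul_eq_zero Q
  rw [← hQK] at hK
  have hPQ' := hPQ.map hℓ φ.toHom hP hQ fun x hx ↦ hK x hx
  have hP' : ℓ ^ m • φ.toHom (ℓ ^ r • P) = 0 := by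
    rw [← map_nsmul, ← mul_nsmul', ← pow_add, hP, map_zero]
  have hQ' : ℓ ^ m • φ.toHom Q = 0 := by
    rw [← map_nsmul, hQK]
    exact hKker
  obtain ⟨b, hb₀, hb₁⟩ := hPQ.exists_basis (pow_ne_zero _ hℓ.ne_zero) hP hQ
  obtain ⟨b', hb'₀, hb'₁⟩ := hPQ'.exists_basis (pow_ne_zero _ hℓ.ne_zero) hP' hQ'
  refine ⟨b, b', by rw [hb'₀, hb₀], by rw [hb'₁, hb₁], fun σ ↦ ?_⟩
  have htors {R : Pts E} (hR : ℓ ^ (m + r) • R = 0) : ℓ ^ (m + r) • galAct E σ R = 0 := by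
    rw [← map_nsmul, hR, map_zero]
  obtain ⟨A, B, hA⟩ := exists_eq_zsmul_add_zsmul b (htors hP)
  obtain ⟨C, D, hC⟩ := exists_eq_zsmul_add_zsmul b (htors hQ)
  rw [hb₀, hb₁] at hA hC
  obtain ⟨j, hj⟩ := hK (galAct E σ (ℓ ^ m • Q))
    (by
      change φ.toHom _ = 0
      rw [φ.toHom_galAct, map_nsmul φ.toHom, hQ', map_zero]) r
    (by rw [← map_nsmul, hQK, ← hKord, addOrderOf_nsmul_eq_zero, map_zero])
  rw [map_nsmul] at hj
  have hdvd := hPQ.pow_dvd_coeff hℓ hC hj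
  refine ⟨A, B, C, D, coe_modRep_eq b σ (by rw [hb₀, hb₁, hA]) (by rw [hb₀, hb₁, hC]), hdvd,
    coe_modRep_eq b' σ ?_ ?_⟩
  · rw [hb'₀, hb'₁, ← φ.toHom_galAct, map_nsmul (galAct E σ), hA, ← map_zsmul, ← map_zsmul,
      ← map_add]
    congr 1
    rw [← natCast_zsmul, ← natCast_zsmul, zsmul_add, ← mul_zsmul', ← mul_zsmul', ← mul_zsmul']
    push_cast
    rw [mul_comm A, mul_comm B]
  · obtain ⟨c, rfl⟩ := hdvd
    have hne : (ℓ : ℤ) ^ r ≠ 0 := pow_ne_zero r (by exact_mod_cast hℓ.ne_zero)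
    rw [Int.mul_ediv_cancel_left _ hne]
    rw [hb'₀, hb'₁, ← φ.toHom_galAct, hC, ← map_zsmul, ← map_zsmul, ← map_add]
    congr 2
    rw [← natCast_zsmul, ← mul_zsmul']
    push_cast
    rfl

end EllipticCurve

end EllQ

/-! ### Scalars in the adic image -/

namespace EllQ

variable {E E' : WeierstrassCurve ℚ} {ℓ : ℕ}

theorem galAct_eq_of_coe_modRep_eq {n : ℕ} (b : Module.Basis (Fin 2) (ZMod n) (Tors E n)) (σ : GQ)
    {a : ℤ} (h : (modRep E n b σ : Matrix (Fin 2) (Fin 2) (ZMod n)) =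
      !![(a : ZMod n), 0; 0, (a : ZMod n)]) {P : Pts E} (hP : n • P = 0) :
    galAct E σ P = a • P := by
  have hσ : torsAct E n σ = (a : ZMod n) • LinearMap.id := by
    refine (LinearMap.toMatrixAlgEquiv b).injective ?_
    rw [map_smul]
    refine Eq.trans h ?_
    ext i j
    fin_cases i <;> fin_cases j <;> simp [LinearMap.toMatrixAlgEquiv_apply]
  have := congrArg Subtype.val (LinearMap.congr_fun hσ ⟨P, mem_torsionBy.mpr hP⟩)
  rw [coe_torsAct] at this
  rw [this, LinearMap.smul_apply, coe_intCast_smul]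
  rfl

theorem coe_modRep_eq_of_galAct_eq {n : ℕ} (b : Module.Basis (Fin 2) (ZMod n) (Tors E n)) (σ : GQ)
    {a : ℤ} (h : ∀ P : Pts E, n • P = 0 → galAct E σ P = a • P) :
    (modRep E n b σ : Matrix (Fin 2) (Fin 2) (ZMod n)) =
      !![(a : ZMod n), 0; 0, (a : ZMod n)] := by
  have := coe_modRep_eq b σ (A := a) (B := 0) (C := 0) (D := a)
    (by rw [h _ (nsmul_coe_tors _), zero_zsmul, add_zero])
    (by rw [h _ (nsmul_coe_tors _), zero_zsmul, zero_add])
  rw [this, Int.cast_zero]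

variable [Fact ℓ.Prime]

theorem mem_adicImage (t : TateBasis ℓ E) (M : GL (Fin 2) ℤ_[ℓ]) :
    M ∈ adicImage t ↔ ∀ n, ∃ σ, modRep E (ℓ ^ n) (t.basis n) σ =
      Matrix.GeneralLinearGroup.map (PadicInt.toZModPow n) M := by
  simp only [adicImage, Subgroup.mem_iInf, Subgroup.mem_comap, MonoidHom.mem_range]

theorem coe_map_scalar (n : ℕ) {M : GL (Fin 2) ℤ_[ℓ]} {a : ℤ}
    (hM : (M : Matrix (Fin 2) (Fin 2) ℤ_[ℓ]) = !![(a : ℤ_[ℓ]), 0; 0, (a : ℤ_[ℓ])]) :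
    (Matrix.GeneralLinearGroup.map (PadicInt.toZModPow n) M :
      Matrix (Fin 2) (Fin 2) (ZMod (ℓ ^ n))) = !![(a : ZMod (ℓ ^ n)), 0; 0, (a : ZMod (ℓ ^ n))] := by
  ext i j
  rw [Matrix.GeneralLinearGroup.map_apply, hM]
  fin_cases i <;> fin_cases j <;> simp

/-- The `ℓ`-adic image contains the scalar `a` if and only if, at every finite level, some Galois
element acts on the torsion as multiplication by `a`. In particular this does not depend on the
basis of the Tate module. -/
theorem containsScalar_adicImage_iff (t : TateBasis ℓ E) {a : ℤ} (ha : ¬ (ℓ : ℤ) ∣ a) :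
    ContainsScalar (adicImage t) (a : ℤ_[ℓ]) ↔
      ∀ n, ∃ σ : GQ, ∀ P : Pts E, ℓ ^ n • P = 0 → galAct E σ P = a • P := by
  constructor
  · rintro ⟨M, hM, hMa⟩ n
    obtain ⟨σ, hσ⟩ := (mem_adicImage t M).mp hM n
    exact ⟨σ, fun P hP ↦ galAct_eq_of_coe_modRep_eq (t.basis n) σ
      (by rw [hσ, coe_map_scalar n hMa]) hP⟩
  · intro h
    have hu : IsUnit (a : ℤ_[ℓ]) := by
      rw [PadicInt.isUnit_iff]
      refine le_antisymm (PadicInt.norm_le_one _) (not_lt.mp fun hlt ↦ ha ?_)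
      exact (PadicInt.norm_int_lt_one_iff_dvd a).mp hlt
    let M : GL (Fin 2) ℤ_[ℓ] :=
      Matrix.GeneralLinearGroup.mk'' !![(a : ℤ_[ℓ]), 0; 0, (a : ℤ_[ℓ])]
        (by rw [Matrix.det_fin_two_of]; simpa using hu)
    have hM : (M : Matrix (Fin 2) (Fin 2) ℤ_[ℓ]) = !![(a : ℤ_[ℓ]), 0; 0, (a : ℤ_[ℓ])] := rfl
    refine ⟨M, (mem_adicImage t M).mpr fun n ↦ ?_, hM⟩
    obtain ⟨σ, hσ⟩ := h n
    exact ⟨σ, Units.ext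
      ((coe_modRep_eq_of_galAct_eq (t.basis n) σ hσ).trans (coe_map_scalar n hM).symm)⟩

theorem neg_one_mem_iff_containsScalar (H : Subgroup (GL (Fin 2) ℤ_[ℓ])) :
    -1 ∈ H ↔ ContainsScalar H ((-1 : ℤ) : ℤ_[ℓ]) := by
  have e : ((-1 : GL (Fin 2) ℤ_[ℓ]) : Matrix (Fin 2) (Fin 2) ℤ_[ℓ]) =
      !![((-1 : ℤ) : ℤ_[ℓ]), 0; 0, ((-1 : ℤ) : ℤ_[ℓ])] := by
    ext i j
    fin_cases i <;> fin_cases j <;> simp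
  constructor
  · exact fun h ↦ ⟨-1, h, e⟩
  · rintro ⟨M, hM, hM'⟩
    rwa [Units.ext (e.trans hM'.symm)]

theorem nsmul_zsmul_comm {A : Type*} [AddCommGroup A] (n : ℕ) (a : ℤ) (x : A) :
    n • (a • x) = a • (n • x) := smul_comm n a x

/-- Every `ℓ ^ m`-torsion point of `E'` is the image of an `ℓ ^ (m + r)`-torsion point of `E`. -/
theorem exists_torsion_preimage [E.IsElliptic] [E'.IsElliptic]
    (φ : Isogeny E E') [Finite φ.ker] [IsAddCyclic φ.ker] {r : ℕ}
    (hr : ℓ ^ r ∣ Nat.card φ.ker) (hr' : ¬ ℓ ^ (r + 1) ∣ Nat.card φ.ker) {m : ℕ} {P' : Pts E'}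
    (hP' : ℓ ^ m • P' = 0) : ∃ P : Pts E, ℓ ^ (m + r) • P = 0 ∧ φ.toHom P = P' := by
  obtain ⟨b, b', hb'₀, hb'₁, -⟩ := exists_bases_modRep φ (Fact.out : ℓ.Prime) hr hr' m
  obtain ⟨x, y, h⟩ := exists_eq_zsmul_add_zsmul b' hP'
  refine ⟨x • (ℓ ^ r • (b 0 : Pts E)) + y • (b 1 : Pts E), ?_, ?_⟩
  · rw [nsmul_add, nsmul_zsmul_comm, nsmul_zsmul_comm, nsmul_coe_tors, nsmul_left_comm, nsmul_coe_tors]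
    simp only [nsmul_zero, zsmul_zero, add_zero]
  · rw [map_add, map_zsmul, map_zsmul, ← hb'₀, ← hb'₁, h]

/-- The `ℓ`-adic images of isogenous curves contain the same scalars. No dual isogeny is needed:
scalar actions are transported forwards by images and backwards by division by `ℓ ^ r`. -/
theorem containsScalar_adicImage_iff_of_isogeny [E.IsElliptic] [E'.IsElliptic]
    (φ : Isogeny E E') [Finite φ.ker] [IsAddCyclic φ.ker] (t : TateBasis ℓ E)
    (t' : TateBasis ℓ E') {a : ℤ} (ha : ¬ (ℓ : ℤ) ∣ a) {r : ℕ}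
    (hr : ℓ ^ r ∣ Nat.card φ.ker) (hr' : ¬ ℓ ^ (r + 1) ∣ Nat.card φ.ker) :
    ContainsScalar (adicImage t) (a : ℤ_[ℓ]) ↔ ContainsScalar (adicImage t') (a : ℤ_[ℓ]) := by
  have hℓ : ℓ.Prime := Fact.out
  rw [containsScalar_adicImage_iff t ha, containsScalar_adicImage_iff t' ha]
  constructor
  · intro h m
    obtain ⟨σ, hσ⟩ := h (m + r)
    refine ⟨σ, fun P' hP' ↦ ?_⟩
    obtain ⟨P, hP, rfl⟩ := exists_torsion_preimage φ hr hr' hP'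
    rw [← φ.toHom_galAct, hσ P hP, map_zsmul]
  · intro h m
    obtain ⟨σ, hσ⟩ := h (m + r)
    obtain ⟨K, -, hKord, hK⟩ := exists_generator_primary hℓ φ.ker hr hr'
    refine ⟨σ, fun P hP ↦ ?_⟩
    obtain ⟨R, rfl⟩ := (hasTorsionRankTwo E).exists_nsmul_eq (pow_ne_zero r hℓ.ne_zero) P
    have hR : ℓ ^ (m + r) • R = 0 := by rw [pow_add, mul_nsmul', hP]
    -- `σ R - a R` lies in the `ℓ`-primary part of the kernel, which is killed by `ℓ ^ r`
    obtain ⟨j, hj⟩ := hK (galAct E σ R - a • R)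
      (by
        change φ.toHom _ = 0
        rw [map_sub, φ.toHom_galAct, map_zsmul,
          hσ _ (by rw [← map_nsmul, hR, map_zero]), sub_self]) (m + r)
      (by rw [nsmul_sub, ← map_nsmul, hR, map_zero, nsmul_zsmul_comm, hR,
            zsmul_zero, sub_zero])
    have h0 : ℓ ^ r • (galAct E σ R - a • R) = 0 := by
      rw [hj, nsmul_zsmul_comm, ← hKord, addOrderOf_nsmul_eq_zero,
        zsmul_zero]
    rw [nsmul_sub, sub_eq_zero] at h0
    rw [map_nsmul, h0, nsmul_zsmul_comm]

end EllQ

/-! ### Isogenies of degree prime to `ℓ` -/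

namespace EllQ

variable {E E' : WeierstrassCurve ℚ} {ℓ : ℕ}

/-- The map induced by an isogeny on `n`-torsion points. -/
noncomputable def Isogeny.torsMap (φ : Isogeny E E') (n : ℕ) : Tors E n →ₗ[ZMod n] Tors E' n :=
  AddMonoidHom.toZModLinearMap n
    ((φ.toHom.comp (AddSubgroup.torsionBy (Pts E) (n : ℤ)).subtype).codRestrict
      (AddSubgroup.torsionBy (Pts E') (n : ℤ)) fun P ↦ mem_torsionBy.mpr (by
        change n • φ.toHom (P : Pts E) = 0
        rw [← map_nsmul, nsmul_coe_tors, map_zero]))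

theorem Isogeny.coe_torsMap (φ : Isogeny E E') (n : ℕ) (P : Tors E n) :
    (φ.torsMap n P : Pts E') = φ.toHom P := rfl

theorem Isogeny.torsMap_bijective [E.IsElliptic] [E'.IsElliptic] (φ : Isogeny E E')
    {n : ℕ} (hn : n ≠ 0) (h : ∀ P : Pts E, n • P = 0 → φ.toHom P = 0 → P = 0) :
    Function.Bijective (φ.torsMap n) := by
  have := finite_tors (E := E') hn
  have hinj : Function.Injective (φ.torsMap n) := by
    rw [injective_iff_map_eq_zero]
    intro P hP
    exact Subtype.ext (h P (nsmul_coe_tors P) (congrArg Subtype.val hP))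
  exact hinj.bijective_of_nat_card_le (by rw [card_tors hn, card_tors hn])

/-- The matrix of an isogeny on `n`-torsion intertwines the mod-`n` representations. -/
theorem Isogeny.modRep_mul_toMatrix (φ : Isogeny E E') {n : ℕ}
    (b : Module.Basis (Fin 2) (ZMod n) (Tors E n)) (b' : Module.Basis (Fin 2) (ZMod n) (Tors E' n))
    (σ : GQ) :
    (modRep E' n b' σ : Matrix (Fin 2) (Fin 2) (ZMod n)) * LinearMap.toMatrix b b' (φ.torsMap n) =
      LinearMap.toMatrix b b' (φ.torsMap n) * (modRep E n b σ : Matrix (Fin 2) (Fin 2) (ZMod n)) := by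
  change LinearMap.toMatrix b' b' (torsAct E' n σ) * _ =
    _ * LinearMap.toMatrix b b (torsAct E n σ)
  rw [← LinearMap.toMatrix_comp, ← LinearMap.toMatrix_comp]
  congr 1
  ext P
  exact (φ.toHom_galAct σ P).symm

theorem Isogeny.toHom_basis_eq (φ : Isogeny E E') {n : ℕ}
    (b : Module.Basis (Fin 2) (ZMod n) (Tors E n)) (b' : Module.Basis (Fin 2) (ZMod n) (Tors E' n))
    (a : Fin 2 → ℤ) (j : Fin 2)
    (h : ∀ i, LinearMap.toMatrix b b' (φ.torsMap n) i j = (a i : ZMod n)) :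
    φ.toHom (b j : Pts E) = a 0 • (b' 0 : Pts E') + a 1 • (b' 1 : Pts E') := by
  simp only [LinearMap.toMatrix_apply] at h
  have := b'.sum_repr (φ.torsMap n (b j))
  rw [Fin.sum_univ_two, h, h] at this
  rw [← φ.coe_torsMap, ← this, AddSubgroup.coe_add, coe_intCast_smul, coe_intCast_smul]

variable [Fact ℓ.Prime]

/-- The matrices of an isogeny on the groups of `ℓ ^ n`-torsion points, in bases of the Tate
modules, are the reductions of a matrix over the `ℓ`-adic integers. -/
theorem Isogeny.exists_adic_matrix (φ : Isogeny E E') (t : TateBasis ℓ E) (t' : TateBasis ℓ E') :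
    ∃ g : Matrix (Fin 2) (Fin 2) ℤ_[ℓ], ∀ n, g.map (PadicInt.toZModPow n) =
      LinearMap.toMatrix (t.basis n) (t'.basis n) (φ.torsMap (ℓ ^ n)) := by
  choose a ha using fun (n : ℕ) (i j : Fin 2) ↦ ZMod.intCast_surjective
    (LinearMap.toMatrix (t.basis n) (t'.basis n) (φ.torsMap (ℓ ^ n)) i j)
  have hφ (n : ℕ) (j : Fin 2) := φ.toHom_basis_eq (t.basis n) (t'.basis n)
    (fun i ↦ a n i j) j fun i ↦ (ha n i j).symm
  -- multiplying the relation at level `n + 1` by `ℓ` gives the relation at level `n`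
  have hcompat (n : ℕ) (i j : Fin 2) : (ℓ : ℤ) ^ n ∣ a (n + 1) i j - a n i j := by
    have h₁ := congrArg (ℓ • ·) (hφ (n + 1) j)
    simp only [nsmul_add] at h₁
    rw [← map_nsmul, t.compat, nsmul_zsmul_comm, nsmul_zsmul_comm, t'.compat, t'.compat, hφ n j] at h₁
    obtain ⟨h0, h1⟩ := indepPair_basis (t'.basis n) (a (n + 1) 0 j - a n 0 j)
      (a (n + 1) 1 j - a n 1 j) (by 
        rw [sub_zsmul, sub_zsmul, ← sub_eq_add_neg, ← sub_eq_add_neg, sub_add_sub_comm, h₁,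
          sub_self])
    push_cast at h0 h1
    fin_cases i
    · exact h0
    · exact h1
  refine ⟨Matrix.of fun i j ↦ PadicInt.ofIntSeq _
    (PadicInt.isCauSeq_padicNorm_of_pow_dvd_sub (a · i j) ℓ (hcompat · i j)), fun n ↦ ?_⟩
  ext i j
  rw [Matrix.map_apply, Matrix.of_apply,
    PadicInt.toZModPow_ofIntSeq_of_pow_dvd_sub (a · i j) ℓ (hcompat · i j), ha]

theorem isUnit_of_isUnit_toZModPow_one {x : ℤ_[ℓ]} (h : IsUnit (PadicInt.toZModPow 1 x)) :
    IsUnit x := by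
  have : Fact (1 < ℓ ^ 1) := ⟨by rw [pow_one]; exact (Fact.out : ℓ.Prime).one_lt⟩
  by_contra hx
  have hmem : x ∈ RingHom.ker (PadicInt.toZModPow (p := ℓ) 1) := by
    rw [PadicInt.ker_toZModPow, pow_one, ← PadicInt.maximalIdeal_eq_span_p]
    exact hx
  rw [RingHom.mem_ker.mp hmem] at h
  exact not_isUnit_zero h

/-- An isogeny of degree prime to `ℓ` is an isomorphism on Tate modules, so it conjugates the
`ℓ`-adic images. -/
theorem Isogeny.exists_conj_adicImage [E.IsElliptic] [E'.IsElliptic]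
    (φ : Isogeny E E') [Finite φ.ker] [IsAddCyclic φ.ker] (hdeg : ¬ ℓ ∣ Nat.card φ.ker)
    (t : TateBasis ℓ E) (t' : TateBasis ℓ E') :
    ∃ g : GL (Fin 2) ℤ_[ℓ],
      adicImage t' = (adicImage t).map (MulAut.conj g).toMonoidHom := by
  have hℓ : ℓ.Prime := Fact.out
  obtain ⟨K, -, hKord, hK⟩ := exists_generator_primary hℓ φ.ker (r := 0) (by simp)
    (by simpa using hdeg)
  obtain rfl : K = 0 := AddMonoid.addOrderOf_eq_one_iff.mp hKord
  have hbij (n : ℕ) : Function.Bijective (φ.torsMap (ℓ ^ n)) := by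
    refine φ.torsMap_bijective (pow_ne_zero n hℓ.ne_zero) fun P hP hφP ↦ ?_
    obtain ⟨j, hj⟩ := hK P hφP n hP
    rw [hj, zsmul_zero]
  obtain ⟨g, hg⟩ := φ.exists_adic_matrix t t'
  have hdet : IsUnit g.det := by
    refine isUnit_of_isUnit_toZModPow_one ?_
    rw [RingHom.map_det, RingHom.mapMatrix_apply, hg]
    exact LinearEquiv.isUnit_det (LinearEquiv.ofBijective _ (hbij 1)) (t.basis 1) (t'.basis 1)
  let G : GL (Fin 2) ℤ_[ℓ] := Matrix.GeneralLinearGroup.mk'' g hdet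
  have hconj (n : ℕ) (σ : GQ) : modRep E' (ℓ ^ n) (t'.basis n) σ =
      Matrix.GeneralLinearGroup.map (PadicInt.toZModPow n) G *
        modRep E (ℓ ^ n) (t.basis n) σ *
        (Matrix.GeneralLinearGroup.map (PadicInt.toZModPow n) G)⁻¹ := by
    rw [eq_mul_inv_iff_mul_eq]
    apply Units.ext
    have hG : (Matrix.GeneralLinearGroup.map (PadicInt.toZModPow n) G :
        Matrix (Fin 2) (Fin 2) (ZMod (ℓ ^ n))) = _ := hg n
    rw [Units.val_mul, Units.val_mul, hG]
    exact φ.modRep_mul_toMatrix (t.basis n) (t'.basis n) σ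
  refine ⟨G, Subgroup.ext fun M ↦ ?_⟩
  rw [Subgroup.mem_map_equiv, mem_adicImage, mem_adicImage]
  refine forall_congr' fun n ↦ exists_congr fun σ ↦ ?_
  rw [hconj, MulAut.conj_symm_apply, map_mul, map_mul, map_inv, mul_inv_eq_iff_eq_mul,
    mul_assoc, eq_inv_mul_iff_mul_eq]

end EllQ

theorem lemma2p10 (E E' : WeierstrassCurve ℚ) [E.IsElliptic] [E'.IsElliptic]
    (φ : EllQ.Isogeny E E') (hfin : Finite φ.ker) (hcyc : IsAddCyclic φ.ker)
    (hrat : EllQ.IsQRational φ.ker)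
    (ℓ : ℕ) [Fact ℓ.Prime] (r : ℕ)
    (hr : ℓ ^ r ∣ Nat.card φ.ker) (hr' : ¬ ℓ ^ (r + 1) ∣ Nat.card φ.ker) :
    -- the Galois matrices of `E` and `E'` in suitable bases
    (∀ m : ℕ,
      ∃ (b : Module.Basis (Fin 2) (ZMod (ℓ ^ (m + r))) (EllQ.Tors E (ℓ ^ (m + r))))
        (b' : Module.Basis (Fin 2) (ZMod (ℓ ^ m)) (EllQ.Tors E' (ℓ ^ m))),
        (b' 0 : EllQ.Pts E') = φ.toHom (ℓ ^ r • (b 0 : EllQ.Pts E)) ∧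
        (b' 1 : EllQ.Pts E') = φ.toHom (b 1 : EllQ.Pts E) ∧
        ∀ σ : EllQ.GQ, ∃ A B C D : ℤ,
          (EllQ.modRep E (ℓ ^ (m + r)) b σ : Matrix (Fin 2) (Fin 2) (ZMod (ℓ ^ (m + r)))) =
            !![(A : ZMod (ℓ ^ (m + r))), (C : ZMod (ℓ ^ (m + r)));
               (B : ZMod (ℓ ^ (m + r))), (D : ZMod (ℓ ^ (m + r)))] ∧
          (ℓ : ℤ) ^ r ∣ C ∧
          (EllQ.modRep E' (ℓ ^ m) b' σ : Matrix (Fin 2) (Fin 2) (ZMod (ℓ ^ m))) =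
            !![(A : ZMod (ℓ ^ m)), ((C / (ℓ : ℤ) ^ r : ℤ) : ZMod (ℓ ^ m));
               (((ℓ : ℤ) ^ r * B : ℤ) : ZMod (ℓ ^ m)), (D : ZMod (ℓ ^ m))]) ∧
    -- the `ℓ`-adic images exist
    Nonempty (EllQ.TateBasis ℓ E) ∧ Nonempty (EllQ.TateBasis ℓ E') ∧
    ∀ (t : EllQ.TateBasis ℓ E) (t' : EllQ.TateBasis ℓ E'),
      -- if the degree is prime to `ℓ`, the `ℓ`-adic images are conjugate
      (¬ ℓ ∣ Nat.card φ.ker →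
        ∃ g : GL (Fin 2) ℤ_[ℓ],
          EllQ.adicImage t' = (EllQ.adicImage t).map (MulAut.conj g).toMonoidHom) ∧
      -- the `ℓ`-adic images contain the same scalars
      (∀ α : ℤ, ¬ (ℓ : ℤ) ∣ α →
        (EllQ.ContainsScalar (EllQ.adicImage t) (α : ℤ_[ℓ]) ↔
          EllQ.ContainsScalar (EllQ.adicImage t') (α : ℤ_[ℓ]))) ∧
      -- in particular, `-Id`
      ((-1 : GL (Fin 2) ℤ_[ℓ]) ∈ EllQ.adicImage t ↔
        (-1 : GL (Fin 2) ℤ_[ℓ]) ∈ EllQ.adicImage t') := by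
  have hℓ : ℓ.Prime := Fact.out
  refine ⟨EllQ.exists_bases_modRep φ hℓ hr hr', EllQ.nonempty_tateBasis hℓ,
    EllQ.nonempty_tateBasis hℓ, fun t t' ↦ ⟨fun hdeg ↦ φ.exists_conj_adicImage hdeg t t',
      fun α hα ↦ EllQ.containsScalar_adicImage_iff_of_isogeny φ t t' hα hr hr', ?_⟩⟩
  have hneg : ¬ (ℓ : ℤ) ∣ -1 := by
    rw [dvd_neg, Int.natCast_dvd_ofNat]
    exact hℓ.not_dvd_one
  rw [EllQ.neg_one_mem_iff_containsScalar, EllQ.neg_one_mem_iff_containsScalar]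
  exact EllQ.containsScalar_adicImage_iff_of_isogeny φ t t' hneg hr hr'
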